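/- For $(s_1,s_2,s_3)\in\mathbb{C}^3$ write $s_j=\sigma_j+it_j$ with $\sigma_j,t_j\in\mathbb{R}$ ($j=1,2,3$). The Mordell–Tornheim double series $$\zeta_{MT,2}(s_1,s_2,s_3)=\sum_{m=1}^\infty\sum_{n=1}^\infty\frac{1}{m^{s_1}n^{s_2}(m+n)^{s_3}}$$ converges absolutely for $\sigma_1+\sigma_3>1$, $\sigma_2+\sigma_3>1$, $\sigma_1+\sigma_2+\sigma_3>2$, and extends (uniquely) to a holomorphic function, denoted by the same symbol, on the connected open set of all $(s_1,s_2,s_3)$ with $\sigma_1+\sigma_3>\frac12$, $\sigma_2+\sigma_3>\frac12$, $\sigma_1+\sigma_2+\sigma_3>\frac32$ and $s_1+s_3\neq1$, $s_2+s_3\neq1$, $s_1+s_2+s_3\neq2$. Let $\sigma_1\ge0$, $t_1\ge0$, $\sigma_2\ge0$, $t_2\ge0$, $\sigma_3>\max\{0,\frac12-\sigma_1,\frac12-\sigma_2,\frac32-\sigma_1-\sigma_2\}$ and $t_3\ge2$, and assume $s_1+s_3\neq1$, $s_2+s_3\neq1$, $s_1+s_2+s_3\neq2$. Put $b=\max\{1,|t_1|,|t_2|\}$.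 Then $$\zeta_{MT,2}(s_1,s_2,s_3)=\sum_{1\le m\le bt_3}\ \sum_{1\le n\le bt_3}\frac{1}{m^{s_1}n^{s_2}(m+n)^{s_3}}+E(s_1,s_2,s_3),$$ where $$E(s_1,s_2,s_3)=\begin{cases}O\big(t_3^{-\min\{\sigma_1+\sigma_3,\,\sigma_2+\sigma_3\}}\big)&\text{if }\max\{\sigma_1,\sigma_2\}>\frac32,\\[2pt] O\big(t_3^{-\min\{\sigma_1+\sigma_3,\,\sigma_2+\sigma_3\}}\log t_3\big)&\text{if }\max\{\sigma_1,\sigma_2\}=\frac32,\\[2pt] O\big(t_3^{3/2-\sigma_1-\sigma_2-\sigma_3}\big)&\text{if }\sigma_1<\frac32\text{ and }\sigma_2<\frac32,\end{cases}$$ and the implicit constants depend only on $s_1$, $s_2$ and $\sigma_3$ (so the bounds hold for all $t_3\ge2$). -/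

import Mathlib

/-- The general term `m ^ (-s₁) * n ^ (-s₂) * (m + n) ^ (-s₃)` of the Mordell–Tornheim double
series, with `s = (s₁, s₂, s₃)`. It is used for `m, n ≥ 1` only. -/
noncomputable def mtTerm (s : ℂ × ℂ × ℂ) (m n : ℕ) : ℂ :=
  1 / ((m : ℂ) ^ s.1 * (n : ℂ) ^ s.2.1 * ((m : ℂ) + (n : ℂ)) ^ s.2.2)

/-- The domain of absolute convergence
`σ₁ + σ₃ > 1`, `σ₂ + σ₃ > 1`, `σ₁ + σ₂ + σ₃ > 2` of the double series. -/
def mtConvergenceDomain : Set (ℂ × ℂ × ℂ) :=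
  {s | 1 < s.1.re + s.2.2.re ∧ 1 < s.2.1.re + s.2.2.re ∧
    2 < s.1.re + s.2.1.re + s.2.2.re}

/-- The open set `σ₁ + σ₃ > 1/2`, `σ₂ + σ₃ > 1/2`, `σ₁ + σ₂ + σ₃ > 3/2`, with the singular
hyperplanes `s₁ + s₃ = 1`, `s₂ + s₃ = 1`, `s₁ + s₂ + s₃ = 2` removed. It is connected (a convex
open set minus three complex hyperplanes) and contains the domain of absolute convergence. -/
def mtHolomorphyDomain : Set (ℂ × ℂ × ℂ) :=
  {s | 1 / 2 < s.1.re + s.2.2.re ∧ 1 / 2 < s.2.1.re + s.2.2.re ∧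
    3 / 2 < s.1.re + s.2.1.re + s.2.2.re ∧
    s.1 + s.2.2 ≠ 1 ∧ s.2.1 + s.2.2 ≠ 1 ∧ s.1 + s.2.1 + s.2.2 ≠ 2}

/-- `F` is holomorphic, as a function of three complex variables, on `mtHolomorphyDomain`, and
equals the (unconditionally convergent) Mordell–Tornheim double series on
`mtConvergenceDomain`. By the identity theorem, such an `F` is unique on `mtHolomorphyDomain`. -/
def IsMTContinuation (F : ℂ × ℂ × ℂ → ℂ) : Prop :=
  DifferentiableOn ℂ F mtHolomorphyDomain ∧
    ∀ s ∈ mtConvergenceDomain, HasSum (fun p : ℕ+ × ℕ+ => mtTerm s p.1 p.2) (F s)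

open Classical in
/-- The Mordell–Tornheim double zeta-function, continued analytically to `mtHolomorphyDomain`
(its values outside this set carry no meaning). -/
noncomputable def mordellTornheimZeta : ℂ × ℂ × ℂ → ℂ :=
  if h : ∃ F : ℂ × ℂ × ℂ → ℂ, IsMTContinuation F then h.choose else 0

/-- The finite double sum of the general term over positive integers `m, n ≤ x`. -/
noncomputable def mtPartialSum (s : ℂ × ℂ × ℂ) (x : ℝ) : ℂ :=
  ∑ m ∈ Finset.Icc 1 ⌊x⌋₊, ∑ n ∈ Finset.Icc 1 ⌊x⌋₊, mtTerm s m n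

open Filter Topology

/-! Write σⱼ, tⱼ for real and imaginary parts and S = σ₁ + σ₂ + σ₃. The pairs (m, n) split into the
cone m < n, its mirror image and the diagonal. In row m of the cone, the sum of n^(-s₂) (m+n)^(-s₃)
over n > m is compared, cell by cell, with the integral over v > m. One integration by parts
continues that integral (`mtTailInt`), and by homogeneity it is m^(1-s₂-s₃) times its value for m =
1 (`mtTailInt_self`). The main terms of all rows therefore add up to a multiple of ζ(s₁+s₂+s₃-1),
while the cell errors gain one power and their double sum converges absolutely for σ₂ + σ₃ > 0, S >
1. This gives the continuation `mtExplicit`; `IsMTContinuation.eq_of_im_pos` identifies it with any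
other one at the points needed.

For the truncation at N = ⌊b t₃⌋, `mtCone_sub_mtConeSum` expresses the error through the tails n > N
of the rows m ≤ N, a zeta tail, and the cell errors of the rows m > N. The crux is the bound
N^(-σ₂-σ₃) for a row tail with no loss in t₃ (`exists_norm_mtTail_le`). The integral part has it
because its denominator s₂ + s₃ - 1 is at least t₃, which is comparable to N. The trivial bound for
the cell errors loses a factor ‖s₃‖. It is recovered in the manner of Kusmin and Landau: for x ≥ t₃
the phase of x^(-it₃) turns by at most 2 < 2π per step, so the errors are differences times a slowly
varying coefficient and telescope (`mtCellErr_eq_telescoping`, `exists_norm_tsum_zeta_cellErr_le`).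
Summation by parts then restores the factor n^(-s₂), whose exponent is fixed.

Summing with weights m^(-σ₁) gives N^(max(σ₁, 3/2) - S). All three cases are the one exponent
max(σ₁, σ₂, 3/2) - S; the logarithm of the middle case is not needed. -/

/-! ### Cauchy estimates and holomorphic series -/

/-- The one-variable Cauchy estimate on the complex line through y in direction v: a disc of radius
R / (4‖v‖) moves y by at most R/4, so it stays inside the ball. -/
theorem norm_fderiv_le_of_forall_mem_ball_norm_le {E : Type*} [NormedAddCommGroup E]
    [NormedSpace ℂ E] {f : E → ℂ} {x y : E} {R M : ℝ} (hR : 0 < R)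
    (hf : DifferentiableOn ℂ f (Metric.ball x R)) (hM : ∀ z ∈ Metric.ball x R, ‖f z‖ ≤ M)
    (hy : y ∈ Metric.ball x (R / 2)) : ‖fderiv ℂ f y‖ ≤ 4 * M / R := by
  have hyR : y ∈ Metric.ball x R := Metric.ball_subset_ball (by linarith) hy
  have hM0 : 0 ≤ M := (norm_nonneg _).trans (hM y hyR)
  refine ContinuousLinearMap.opNorm_le_bound _ (by positivity) fun v => ?_
  rcases eq_or_ne v 0 with rfl | hv
  · simp
  have hv' : 0 < ‖v‖ := norm_pos_iff.2 hv
  have hmem : ∀ z ∈ Metric.closedBall (0 : ℂ) (R / (4 * ‖v‖)), y + z • v ∈ Metric.ball x R := by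
    intro z hz
    rw [mem_closedBall_zero_iff, le_div_iff₀ (by positivity)] at hz
    rw [Metric.mem_ball, dist_eq_norm] at hy ⊢
    calc ‖y + z • v - x‖ = ‖(y - x) + z • v‖ := by congr 1; abel
      _ ≤ ‖y - x‖ + ‖z‖ * ‖v‖ := (norm_add_le _ _).trans (by rw [norm_smul])
      _ < R := by linarith
  have hline : ∀ z : ℂ, HasDerivAt (fun z : ℂ => y + z • v) v z := fun z => by
    simpa using ((hasDerivAt_id z).smul_const v).const_add y
  have hd : ∀ z ∈ Metric.closedBall (0 : ℂ) (R / (4 * ‖v‖)),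
      HasDerivAt (fun z : ℂ => f (y + z • v)) (fderiv ℂ f (y + z • v) v) z := fun z hz =>
    ((hf.differentiableAt (Metric.isOpen_ball.mem_nhds (hmem z hz))).hasFDerivAt).comp_hasDerivAt
      z (hline z)
  have hpos : 0 < R / (4 * ‖v‖) := by positivity
  have key := Complex.norm_deriv_le_of_forall_mem_sphere_norm_le (c := 0) (C := M) hpos
    (f := fun z : ℂ => f (y + z • v))
    (DifferentiableOn.diffContOnCl_ball (U := Metric.closedBall 0 (R / (4 * ‖v‖)))
      (fun z hz => (hd z hz).differentiableAt.differentiableWithinAt) le_rfl)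
    (fun z hz => hM _ (hmem z (Metric.sphere_subset_closedBall hz)))
  rw [(hd 0 (Metric.mem_closedBall_self hpos.le)).deriv] at key
  simp only [zero_smul, add_zero] at key
  refine key.trans (le_of_eq ?_)
  field_simp

/-- Weierstrass M-test: by Cauchy's estimate a local majorant of the terms also majorizes the
derivatives on a half ball, so termwise differentiation applies. -/
theorem differentiableOn_tsum_of_locally_norm_le {ι E : Type*} [NormedAddCommGroup E]
    [NormedSpace ℂ E] {F : ι → E → ℂ} {U : Set E} (hU : IsOpen U)
    (hF : ∀ i, DifferentiableOn ℂ (F i) U)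
    (hb : ∀ x ∈ U, ∃ r > 0, ∃ u : ι → ℝ, Summable u ∧
      ∀ y ∈ Metric.ball x r, ∀ i, ‖F i y‖ ≤ u i) :
    DifferentiableOn ℂ (fun y => ∑' i, F i y) U := by
  intro x hx
  obtain ⟨r, hr, u, hu, hbd⟩ := hb x hx
  obtain ⟨r', hr', hsub⟩ := Metric.isOpen_iff.1 hU x hx
  set R := min r r' with hRdef
  have hR : 0 < R := lt_min hr hr'
  have h1 : Metric.ball x R ⊆ Metric.ball x r := Metric.ball_subset_ball (min_le_left _ _)
  have h2 : Metric.ball x R ⊆ U := (Metric.ball_subset_ball (min_le_right _ _)).trans hsub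
  have hx2 : x ∈ Metric.ball x (R / 2) := Metric.mem_ball_self (by positivity)
  have h3 : Metric.ball x (R / 2) ⊆ Metric.ball x R := Metric.ball_subset_ball (by linarith)
  refine (hasFDerivAt_tsum_of_isPreconnected (𝕜 := ℂ) (u := fun i => 4 * u i / R)
    (f' := fun i y => fderiv ℂ (F i) y) ((hu.mul_left 4).div_const R)
    (Metric.isOpen_ball (x := x) (ε := R / 2)) (Metric.isPreconnected_ball) (fun i y hy =>
      ((hF i).differentiableAt (hU.mem_nhds (h2 (h3 hy)))).hasFDerivAt) (fun i y hy => ?_) hx2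
      (hu.of_norm_bounded fun i => hbd x (Metric.mem_ball_self hr) i) hx2
      ).differentiableAt.differentiableWithinAt
  exact norm_fderiv_le_of_forall_mem_ball_norm_le hR ((hF i).mono h2)
    (fun z hz => hbd z (h1 hz) i) hy

/-! ### Power tails, cone sums and telescoping -/

/-- Mean value theorem on [x, x + 1]; the intermediate point is at most 2x, which costs 2^(α+1).
Power tails are thus dominated by telescoping series. -/
theorem rpow_neg_sub_one_le_sub {α x : ℝ} (hα : 0 < α) (hx : 1 ≤ x) :
    x ^ (-α - 1) ≤ 2 ^ (α + 1) / α * (x ^ (-α) - (x + 1) ^ (-α)) := by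
  have hx0 : 0 < x := by linarith
  obtain ⟨c, hc, hc'⟩ := exists_deriv_eq_slope (fun y : ℝ => -y ^ (-α)) (show x < x + 1 by linarith)
    (by
      refine ContinuousOn.neg (ContinuousOn.rpow_const continuousOn_id fun y hy => Or.inl ?_)
      have := hy.1; linarith)
    (fun y hy => by
      have : y ≠ 0 := by have := hy.1; linarith
      exact ((Real.hasDerivAt_rpow_const (Or.inl this)).fun_neg).differentiableAt.differentiableWithinAt)
  have hc0 : 0 < c := by linarith [hc.1]
  rw [((Real.hasDerivAt_rpow_const (p := -α) (Or.inl hc0.ne')).fun_neg).deriv] at hc'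
  have h1 : x ^ (-α) - (x + 1) ^ (-α) = α * c ^ (-α - 1) := by
    have : x + 1 - x = 1 := by ring
    rw [this, div_one] at hc'
    linarith
  rw [h1]
  have h2 : (2 * x) ^ (-α - 1) ≤ c ^ (-α - 1) :=
    Real.rpow_le_rpow_of_nonpos hc0 (by linarith [hc.2]) (by linarith)
  rw [Real.mul_rpow (by norm_num) hx0.le] at h2
  have h3 : (2 : ℝ) ^ (α + 1) * 2 ^ (-α - 1) = 1 := by
    rw [← Real.rpow_add (by norm_num)]; simp
  have h4 : (0 : ℝ) < 2 ^ (α + 1) := by positivity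
  calc x ^ (-α - 1) = 2 ^ (α + 1) * (2 ^ (-α - 1) * x ^ (-α - 1)) := by rw [← mul_assoc, h3, one_mul]
    _ ≤ 2 ^ (α + 1) * c ^ (-α - 1) := by gcongr
    _ = _ := by field_simp

theorem hasSum_sub_succ {u : ℕ → ℝ} (hu : Antitone u) (h0 : Tendsto u atTop (𝓝 0)) :
    HasSum (fun k => u k - u (k + 1)) (u 0) := by
  rw [hasSum_iff_tendsto_nat_of_nonneg (fun k => sub_nonneg.2 (hu (Nat.le_succ k)))]
  simp_rw [Finset.sum_range_sub']
  simpa using h0.const_sub (u 0)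

theorem tendsto_natCast_add_rpow_neg {α : ℝ} (hα : 0 < α) (N : ℕ) :
    Tendsto (fun k : ℕ => ((N : ℝ) + k) ^ (-α)) atTop (𝓝 0) :=
  (tendsto_rpow_neg_atTop hα).comp (tendsto_atTop_add_const_left _ _ tendsto_natCast_atTop_atTop)

theorem hasSum_rpow_neg_sub {α : ℝ} (hα : 0 < α) {N : ℕ} (hN : 1 ≤ N) :
    HasSum (fun k : ℕ => ((N : ℝ) + k) ^ (-α) - ((N : ℝ) + k + 1) ^ (-α)) ((N : ℝ) ^ (-α)) := by
  have hN' : (1 : ℝ) ≤ N := by exact_mod_cast hN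
  have := hasSum_sub_succ (u := fun k : ℕ => ((N : ℝ) + k) ^ (-α)) (fun i j hij => by
    refine Real.rpow_le_rpow_of_nonpos (by positivity) ?_ (by linarith)
    have : (i : ℝ) ≤ j := by exact_mod_cast hij
    linarith) (tendsto_natCast_add_rpow_neg hα N)
  simpa [add_assoc] using this

theorem summable_rpow_tail {α : ℝ} (hα : 0 < α) {N : ℕ} (hN : 1 ≤ N) :
    Summable fun k : ℕ => ((N : ℝ) + k) ^ (-α - 1) := by
  have hN' : (1 : ℝ) ≤ N := by exact_mod_cast hN
  refine Summable.of_nonneg_of_le (fun k => by positivity) (fun k =>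
    rpow_neg_sub_one_le_sub hα (x := N + k) (by have : (0 : ℝ) ≤ k := k.cast_nonneg
                                                linarith))
    ((hasSum_rpow_neg_sub hα hN).summable.mul_left _)

theorem tsum_rpow_tail_le {α : ℝ} (hα : 0 < α) {N : ℕ} (hN : 1 ≤ N) :
    ∑' k : ℕ, ((N : ℝ) + k) ^ (-α - 1) ≤ 2 ^ (α + 1) / α * (N : ℝ) ^ (-α) := by
  have hN' : (1 : ℝ) ≤ N := by exact_mod_cast hN
  have h := (hasSum_rpow_neg_sub hα hN).mul_left (2 ^ (α + 1) / α)
  rw [← h.tsum_eq]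
  refine (summable_rpow_tail hα hN).tsum_le_tsum (fun k =>
    rpow_neg_sub_one_le_sub hα (x := N + k) (by have : (0 : ℝ) ≤ k := k.cast_nonneg
                                                linarith)) h.summable

theorem norm_tsum_le_rpow_tail {α C : ℝ} (hα : 0 < α) {N : ℕ} (hN : 1 ≤ N) {u : ℕ → ℂ}
    (hu : ∀ k : ℕ, ‖u k‖ ≤ C * ((N : ℝ) + k) ^ (-α - 1)) :
    ‖∑' k, u k‖ ≤ C * (2 ^ (α + 1) / α) * (N : ℝ) ^ (-α) := by
  have hC : 0 ≤ C := by
    have h := (norm_nonneg _).trans (hu 0)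
    have hN' : (0 : ℝ) < N := by exact_mod_cast hN
    exact nonneg_of_mul_nonneg_left h (by positivity)
  have hs := (summable_rpow_tail hα hN).mul_left C
  calc ‖∑' k, u k‖ ≤ ∑' k : ℕ, C * ((N : ℝ) + k) ^ (-α - 1) :=
        tsum_of_norm_bounded hs.hasSum hu
    _ ≤ C * (2 ^ (α + 1) / α * (N : ℝ) ^ (-α)) := by
        rw [tsum_mul_left]; exact mul_le_mul_of_nonneg_left (tsum_rpow_tail_le hα hN) hC
    _ = _ := by ring

theorem summable_of_norm_le_rpow_tail {α C : ℝ} (hα : 0 < α) {N : ℕ} (hN : 1 ≤ N) {u : ℕ → ℂ}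
    (hu : ∀ k : ℕ, ‖u k‖ ≤ C * ((N : ℝ) + k) ^ (-α - 1)) : Summable u :=
  ((summable_rpow_tail hα hN).mul_left C).of_norm_bounded hu

/-- The inner sum needs only 1 + ε of the exponent b. The remaining b - 1 - ε > 0 is moved onto the
first variable, leaving a product of two convergent series. -/
theorem summable_rpow_cone {a b : ℝ} (hb : 1 < b) (hab : 2 < a + b) :
    Summable fun p : ℕ × ℕ => ((p.1 : ℝ) + 1) ^ (-a) * ((p.1 : ℝ) + 1 + p.2) ^ (-b) := by
  obtain ⟨ε, hε, hε1, hε2⟩ : ∃ ε : ℝ, 0 < ε ∧ ε < b - 1 ∧ ε < a + b - 2 := by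
    have h : 0 < min (b - 1) (a + b - 2) := lt_min (by linarith) (by linarith)
    refine ⟨min (b - 1) (a + b - 2) / 2, by linarith, ?_, ?_⟩
    · linarith [min_le_left (b - 1) (a + b - 2)]
    · linarith [min_le_right (b - 1) (a + b - 2)]
  have h1 : Summable fun m : ℕ => ((m : ℝ) + 1) ^ (-(a + b - 1 - ε)) := by
    have := summable_rpow_tail (α := a + b - 2 - ε) (by linarith) (N := 1) le_rfl
    refine this.congr fun k => ?_
    rw [Nat.cast_one, add_comm]; congr 1; ring
  have h2 : Summable fun m : ℕ => ((m : ℝ) + 1) ^ (-(1 + ε)) := by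
    have := summable_rpow_tail (α := ε) hε (N := 1) le_rfl
    refine this.congr fun k => ?_
    rw [Nat.cast_one, add_comm]; congr 1; ring
  refine Summable.of_nonneg_of_le (fun p => by positivity) (fun p => ?_)
    (h1.mul_of_nonneg h2 (fun _ => by positivity) (fun _ => by positivity))
  have hp1 : (0 : ℝ) ≤ p.1 := p.1.cast_nonneg
  have hp2 : (0 : ℝ) ≤ p.2 := p.2.cast_nonneg
  have e1 : ((p.1 : ℝ) + 1 + p.2) ^ (-b)
      = ((p.1 : ℝ) + 1 + p.2) ^ (-(b - 1 - ε)) * ((p.1 : ℝ) + 1 + p.2) ^ (-(1 + ε)) := by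
    rw [← Real.rpow_add (by positivity)]; congr 1; ring
  have e2 : ((p.1 : ℝ) + 1) ^ (-(a + b - 1 - ε))
      = ((p.1 : ℝ) + 1) ^ (-a) * ((p.1 : ℝ) + 1) ^ (-(b - 1 - ε)) := by
    rw [← Real.rpow_add (by positivity)]; congr 1; ring
  rw [e1, e2, mul_assoc]
  have i1 : ((p.1 : ℝ) + 1 + p.2) ^ (-(b - 1 - ε)) ≤ ((p.1 : ℝ) + 1) ^ (-(b - 1 - ε)) :=
    Real.rpow_le_rpow_of_nonpos (by positivity) (by linarith) (by linarith)
  have i2 : ((p.1 : ℝ) + 1 + p.2) ^ (-(1 + ε)) ≤ ((p.2 : ℝ) + 1) ^ (-(1 + ε)) :=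
    Real.rpow_le_rpow_of_nonpos (by positivity) (by linarith) (by linarith)
  gcongr

theorem tsum_eq_add_tsum_of_telescoping {u v w : ℕ → ℂ} (hu : Summable u) (hw : Summable w)
    (hv : Tendsto v atTop (𝓝 0)) (h : ∀ k, u k = v k - v (k + 1) + w k) :
    ∑' k, u k = v 0 + ∑' k, w k := by
  refine tendsto_nhds_unique hu.hasSum.tendsto_sum_nat ?_
  have : (fun n => ∑ i ∈ Finset.range n, u i)
      = fun n => v 0 - v n + ∑ i ∈ Finset.range n, w i := by
    funext n
    simp_rw [h, Finset.sum_add_distrib, Finset.sum_range_sub']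
  rw [this]
  simpa using (hv.const_sub (v 0)).add hw.hasSum.tendsto_sum_nat

/-! ### The kernel and its errors on unit cells -/

/-- The function `v ↦ v ^ (-a) * (m + v) ^ (-b)` of a positive real variable. -/
noncomputable def mtKernel (m : ℝ) (a b : ℂ) (v : ℝ) : ℂ :=
  (v : ℂ) ^ (-a) * ((m + v : ℝ) : ℂ) ^ (-b)

theorem norm_mtKernel {m v : ℝ} (hm : 0 ≤ m) (hv : 0 < v) (a b : ℂ) :
    ‖mtKernel m a b v‖ = v ^ (-a.re) * (m + v) ^ (-b.re) := by
  rw [mtKernel, norm_mul, Complex.norm_cpow_eq_rpow_re_of_pos hv,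
    Complex.norm_cpow_eq_rpow_re_of_pos (by linarith)]
  simp

theorem rpow_neg_add_le {m v : ℝ} (hm : 0 ≤ m) (hv : 0 < v) (hmv : m ≤ v) (β : ℝ) :
    (m + v) ^ (-β) ≤ 2 ^ |β| * v ^ (-β) := by
  rcases le_total 0 β with h | h
  · calc (m + v) ^ (-β) ≤ v ^ (-β) :=
          Real.rpow_le_rpow_of_nonpos hv (by linarith) (by linarith)
      _ ≤ 2 ^ |β| * v ^ (-β) :=
          le_mul_of_one_le_left (by positivity) (Real.one_le_rpow (by norm_num) (abs_nonneg _))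
  · calc (m + v) ^ (-β) ≤ (2 * v) ^ (-β) :=
          Real.rpow_le_rpow (by linarith) (by linarith) (by linarith)
      _ = 2 ^ |β| * v ^ (-β) := by
          rw [Real.mul_rpow (by norm_num) hv.le, abs_of_nonpos h]

theorem norm_mtKernel_le {m v : ℝ} (hm : 0 ≤ m) (hv : 0 < v) (hmv : m ≤ v) (a b : ℂ) :
    ‖mtKernel m a b v‖ ≤ 2 ^ |b.re| * v ^ (-(a.re + b.re)) := by
  rw [norm_mtKernel hm hv, neg_add, Real.rpow_add hv]
  calc _ ≤ v ^ (-a.re) * (2 ^ |b.re| * v ^ (-b.re)) := by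
        gcongr; exact rpow_neg_add_le hm hv hmv _
    _ = _ := by ring

theorem hasDerivAt_ofReal_cpow_neg {v : ℝ} (hv : 0 < v) (a : ℂ) :
    HasDerivAt (fun v : ℝ => (v : ℂ) ^ (-a)) ((v : ℂ) ^ (-a) * (-a / v)) v := by
  have hv' : (v : ℂ) ≠ 0 := by exact_mod_cast hv.ne'
  have h := ((Complex.hasStrictDerivAt_cpow_const (c := -a)
    (Or.inl (by simpa using hv) : (v : ℂ) ∈ Complex.slitPlane)).hasDerivAt).comp_ofReal
  refine h.congr_deriv ?_
  rw [Complex.cpow_sub _ _ hv', Complex.cpow_one]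
  field_simp

theorem hasDerivAt_mtKernel {m v : ℝ} (hm : 0 ≤ m) (hv : 0 < v) (a b : ℂ) :
    HasDerivAt (mtKernel m a b)
      (mtKernel m a b v * (-a / (v : ℂ) - b / ((m + v : ℝ) : ℂ))) v := by
  have h1 := hasDerivAt_ofReal_cpow_neg hv a
  have h2 := (hasDerivAt_ofReal_cpow_neg (v := m + v) (by linarith) b).comp_const_add m v
  refine (h1.mul h2).congr_deriv ?_
  rw [mtKernel]; ring

theorem continuousOn_mtKernel {m : ℝ} (hm : 0 ≤ m) (a b : ℂ) :
    ContinuousOn (mtKernel m a b) (Set.Ioi 0) := fun _ hv =>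
  (hasDerivAt_mtKernel hm hv a b).continuousAt.continuousWithinAt

theorem intervalIntegrable_mtKernel {m x y : ℝ} (hm : 0 ≤ m) (hx : 0 < x) (hxy : x ≤ y) (a b : ℂ) :
    IntervalIntegrable (mtKernel m a b) MeasureTheory.volume x y := by
  refine ((continuousOn_mtKernel hm a b).mono ?_).intervalIntegrable
  rw [Set.uIcc_of_le hxy]
  exact fun v hv => hx.trans_le hv.1

theorem mtKernel_add_one_left {m v : ℝ} (hv : 0 < v) (a b : ℂ) :
    mtKernel m (a + 1) b v = mtKernel m a b v / v := by
  have hv' : (v : ℂ) ≠ 0 := by exact_mod_cast hv.ne'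
  rw [mtKernel, mtKernel, neg_add, Complex.cpow_add _ _ hv', Complex.cpow_neg_one]
  ring

theorem mtKernel_sub_one_right {m v : ℝ} (hm : 0 ≤ m) (hv : 0 < v) (a b : ℂ) :
    mtKernel m a (b - 1) v = mtKernel m a b v * ((m + v : ℝ) : ℂ) := by
  have hv' : ((m + v : ℝ) : ℂ) ≠ 0 := by exact_mod_cast (by linarith : 0 < m + v).ne'
  rw [mtKernel, mtKernel, neg_sub, sub_eq_neg_add, Complex.cpow_add _ _ hv', Complex.cpow_one]
  ring

theorem mtKernel_mul {c m v : ℝ} (hc : 0 < c) (hm : 0 ≤ m) (hv : 0 < v) (a b : ℂ) :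
    mtKernel (c * m) a b (c * v) = (c : ℂ) ^ (-(a + b)) * mtKernel m a b v := by
  have hc' : (c : ℂ) ≠ 0 := by exact_mod_cast hc.ne'
  rw [mtKernel, mtKernel, ← mul_add, Complex.ofReal_mul, Complex.ofReal_mul c (m + v),
    Complex.mul_cpow_ofReal_nonneg hc.le hv.le,
    Complex.mul_cpow_ofReal_nonneg hc.le (by linarith), neg_add, Complex.cpow_add _ _ hc']
  ring

/-- The difference between a term and the integral over the preceding unit interval. -/
noncomputable def mtCellErr (m : ℝ) (a b : ℂ) (n : ℝ) : ℂ :=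
  mtKernel m a b (n + 1) - ∫ v in n..(n + 1), mtKernel m a b v

/-- The logarithmic derivative of the kernel is at most (‖a‖ + ‖b‖) / v, so a cell error gains one
power of n. The linear growth in b is harmless for convergence but not for the uniform estimate. -/
theorem norm_mtCellErr_le {m n : ℝ} (hm : 0 ≤ m) (hmn : m ≤ n) (hn : 0 < n) (a b : ℂ)
    (hab : 0 ≤ a.re + b.re) :
    ‖mtCellErr m a b n‖ ≤ (‖a‖ + ‖b‖) * 2 ^ |b.re| * n ^ (-(a.re + b.re) - 1) := by
  set C := (‖a‖ + ‖b‖) * 2 ^ |b.re| * n ^ (-(a.re + b.re) - 1) with hC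
  have hC0 : 0 ≤ C := by positivity
  have hder : ∀ v ∈ Set.Icc n (n + 1),
      ‖mtKernel m a b v * (-a / (v : ℂ) - b / ((m + v : ℝ) : ℂ))‖ ≤ C := by
    intro v hv
    have hv0 : 0 < v := hn.trans_le hv.1
    have h1 : ‖-a / (v : ℂ) - b / ((m + v : ℝ) : ℂ)‖ ≤ (‖a‖ + ‖b‖) * v⁻¹ := by
      refine (norm_sub_le _ _).trans ?_
      rw [norm_div, norm_div, norm_neg, Complex.norm_real, Complex.norm_real, Real.norm_of_nonneg
        hv0.le, Real.norm_of_nonneg (show (0 : ℝ) ≤ m + v by linarith), add_mul, div_eq_mul_inv, div_eq_mul_inv]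
      have h3 : (m + v)⁻¹ ≤ v⁻¹ := inv_anti₀ hv0 (by linarith)
      gcongr
    have h2 := norm_mtKernel_le hm hv0 (hmn.trans hv.1) a b
    rw [norm_mul]
    calc _ ≤ (2 ^ |b.re| * v ^ (-(a.re + b.re))) * ((‖a‖ + ‖b‖) * v⁻¹) := by gcongr
      _ = (‖a‖ + ‖b‖) * 2 ^ |b.re| * v ^ (-(a.re + b.re) - 1) := by
          rw [Real.rpow_sub hv0, Real.rpow_one]; ring
      _ ≤ C := by
          rw [hC]
          exact mul_le_mul_of_nonneg_left (Real.rpow_le_rpow_of_nonpos hn hv.1 (by linarith))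
            (by positivity)
  have hint := intervalIntegrable_mtKernel hm hn (by linarith : n ≤ n + 1) a b
  have heq : mtCellErr m a b n
      = ∫ v in n..(n + 1), (mtKernel m a b (n + 1) - mtKernel m a b v) := by
    rw [intervalIntegral.integral_sub (by simp) hint]
    simp [mtCellErr]
  rw [heq]
  refine (intervalIntegral.norm_integral_le_of_norm_le_const (C := C) fun v hv => ?_).trans
    (by simp)
  rw [Set.uIoc_of_le (by linarith)] at hv
  have := (convex_Icc n (n + 1)).norm_image_sub_le_of_norm_hasDerivWithin_le
    (f := mtKernel m a b) (C := C)
    (fun x hx => (hasDerivAt_mtKernel hm (hn.trans_le hx.1) a b).hasDerivWithinAt) hder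
    (Set.Ioc_subset_Icc_self hv) (Set.right_mem_Icc.2 (by linarith))
  refine this.trans ?_
  rw [Real.norm_of_nonneg (by linarith [hv.2])]
  exact mul_le_of_le_one_right hC0 (by linarith [hv.1])

theorem integrableOn_mtKernel {m N : ℝ} (hm : 0 ≤ m) (hmN : m ≤ N) (hN : 0 < N) {a b : ℂ}
    (hab : 1 < a.re + b.re) : MeasureTheory.IntegrableOn (mtKernel m a b) (Set.Ioi N) := by
  refine MeasureTheory.Integrable.mono' ((integrableOn_Ioi_rpow_of_lt
    (a := -(a.re + b.re)) (by linarith) hN).const_mul (2 ^ |b.re|)) ?_ ?_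
  · exact (((continuousOn_mtKernel hm a b).mono (Set.Ioi_subset_Ioi hN.le)).aestronglyMeasurable
      measurableSet_Ioi)
  · refine (MeasureTheory.ae_restrict_iff' measurableSet_Ioi).2 (Eventually.of_forall fun v hv => ?_)
    exact norm_mtKernel_le hm (hN.trans hv) (hmN.trans (le_of_lt hv)) a b

/-! ### Continuation of the tail integral -/

/-- The improper integral of `mtKernel`. -/
noncomputable def mtImproper (m : ℝ) (a b : ℂ) (N : ℝ) : ℂ :=
  ∫ v in Set.Ioi N, mtKernel m a b v

theorem norm_mtImproper_le {m N : ℝ} (hm : 0 ≤ m) (hmN : m ≤ N) (hN : 0 < N) {a b : ℂ}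
    (hab : 1 < a.re + b.re) :
    ‖mtImproper m a b N‖ ≤ 2 ^ |b.re| * (N ^ (1 - (a.re + b.re)) / (a.re + b.re - 1)) := by
  have h := integral_Ioi_rpow_of_lt (a := -(a.re + b.re)) (by linarith) hN
  have h2 := MeasureTheory.norm_integral_le_of_norm_le (μ := MeasureTheory.volume.restrict
    (Set.Ioi N)) (f := mtKernel m a b) ((integrableOn_Ioi_rpow_of_lt
    (a := -(a.re + b.re)) (by linarith) hN).const_mul (2 ^ |b.re|))
    ((MeasureTheory.ae_restrict_iff' measurableSet_Ioi).2 (Eventually.of_forall fun v hv =>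
      norm_mtKernel_le hm (hN.trans hv) (hmN.trans (le_of_lt hv)) a b))
  rw [MeasureTheory.integral_const_mul, h] at h2
  refine h2.trans (le_of_eq ?_)
  have e1 : -(a.re + b.re) + 1 = 1 - (a.re + b.re) := by ring
  have e2 : a.re + b.re - 1 = -(1 - (a.re + b.re)) := by ring
  rw [e1, e2, neg_div, div_neg]

/-- The analytic continuation to `0 < a.re + b.re` of the integral `∫ v in Ioi N, mtKernel m a b v`,
obtained through an integration by parts. -/
noncomputable def mtTailInt (m : ℝ) (a b : ℂ) (N : ℝ) : ℂ :=
  (mtKernel m a (b - 1) N - a * m * mtImproper m (a + 1) b N) / (a + b - 1)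

/-- Increments of the continued integral are genuine integrals even where the improper integral
diverges; hence the continued tails still shift by single terms. -/
theorem mtTailInt_sub {m N M : ℝ} (hm : 0 ≤ m) (hmN : m ≤ N) (hN : 0 < N) (hNM : N ≤ M) {a b : ℂ}
    (hab : 0 < a.re + b.re) (h1 : a + b ≠ 1) :
    mtTailInt m a b N - mtTailInt m a b M = ∫ v in N..M, mtKernel m a b v := by
  have hab1 : a + b - 1 ≠ 0 := sub_ne_zero.2 h1
  have hW : mtImproper m (a + 1) b N - mtImproper m (a + 1) b M
      = ∫ v in N..M, mtKernel m (a + 1) b v := by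
    refine (intervalIntegral.integral_Ioi_sub_Ioi (integrableOn_mtKernel hm hmN hN ?_) hNM)
    simp only [Complex.add_re, Complex.one_re]; linarith
  -- The integrand is the derivative of v^(-a) (m+v)^(1-b); its second kernel decays one power
  -- faster, which is the source of the continuation.
  have hF : ∫ v in N..M, ((1 - a - b) * mtKernel m a b v - a * m * mtKernel m (a + 1) b v)
      = mtKernel m a (b - 1) M - mtKernel m a (b - 1) N := by
    refine intervalIntegral.integral_eq_sub_of_hasDerivAt (fun v hv => ?_) ?_
    · rw [Set.uIcc_of_le hNM] at hv
      have hv0 : 0 < v := hN.trans_le hv.1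
      refine (hasDerivAt_mtKernel hm hv0 a (b - 1)).congr_deriv ?_
      have hv' : (v : ℂ) ≠ 0 := by exact_mod_cast hv0.ne'
      have hv'' : (m : ℂ) + (v : ℂ) ≠ 0 := by exact_mod_cast (by linarith : 0 < m + v).ne'
      rw [mtKernel_add_one_left hv0, mtKernel_sub_one_right hm hv0, Complex.ofReal_add]
      field_simp
      ring
    · exact ((intervalIntegrable_mtKernel hm hN hNM _ _).const_mul _).sub
        ((intervalIntegrable_mtKernel hm hN hNM _ _).const_mul _)
  rw [intervalIntegral.integral_sub ((intervalIntegrable_mtKernel hm hN hNM _ _).const_mul _)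
    ((intervalIntegrable_mtKernel hm hN hNM _ _).const_mul _),
    intervalIntegral.integral_const_mul, intervalIntegral.integral_const_mul, ← hW] at hF
  rw [mtTailInt, mtTailInt, ← sub_div, div_eq_iff hab1]
  linear_combination hF

/-- The denominator ‖a + b - 1‖ is kept because it later supplies the saving of a factor t₃. -/
theorem norm_mtTailInt_le {m N : ℝ} (hm : 0 ≤ m) (hmN : m ≤ N) (hN : 0 < N) {a b : ℂ}
    (hab : 0 < a.re + b.re) :
    ‖mtTailInt m a b N‖ ≤ 2 ^ |b.re| * (2 + ‖a‖ / (a.re + b.re)) * N ^ (1 - (a.re + b.re)) /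
      ‖a + b - 1‖ := by
  rw [mtTailInt, norm_div]
  gcongr
  refine (norm_sub_le _ _).trans ?_
  have h1 : ‖mtKernel m a (b - 1) N‖ ≤ 2 ^ |b.re| * N ^ (-(a.re + b.re)) * (2 * N) := by
    rw [mtKernel_sub_one_right hm hN, norm_mul, Complex.norm_real, Real.norm_of_nonneg
      (by linarith)]
    have := norm_mtKernel_le hm hN hmN a b
    gcongr
    linarith
  have h2 := norm_mtImproper_le (a := a + 1) (b := b) hm hmN hN
    (by simp only [Complex.add_re, Complex.one_re]; linarith)
  simp only [Complex.add_re, Complex.one_re] at h2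
  have e1 : 1 - (a.re + 1 + b.re) = -(a.re + b.re) := by ring
  have e2 : a.re + 1 + b.re - 1 = a.re + b.re := by ring
  rw [e1, e2] at h2
  have e3 : N ^ (1 - (a.re + b.re)) = N * N ^ (-(a.re + b.re)) := by
    rw [sub_eq_add_neg, Real.rpow_add hN, Real.rpow_one]
  rw [norm_mul, norm_mul, Complex.norm_real, Real.norm_of_nonneg hm, e3]
  calc _ ≤ 2 ^ |b.re| * N ^ (-(a.re + b.re)) * (2 * N) +
        ‖a‖ * N * (2 ^ |b.re| * (N ^ (-(a.re + b.re)) / (a.re + b.re))) := by gcongr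
    _ = _ := by ring

/-- Substitution v ↦ m v: the kernel is jointly homogeneous of degree -(a + b) in (m, v). This
separates m from the integral and produces the zeta factor of the cone. -/
theorem mtTailInt_self {m : ℝ} (hm : 0 < m) (a b : ℂ) :
    mtTailInt m a b m = (m : ℂ) ^ (1 - a - b) * mtTailInt 1 a b 1 := by
  have hm' : (m : ℂ) ≠ 0 := by exact_mod_cast hm.ne'
  have h1 : mtKernel m a (b - 1) m = (m : ℂ) ^ (1 - a - b) * mtKernel 1 a (b - 1) 1 := by
    have := mtKernel_mul hm zero_le_one one_pos a (b - 1)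
    rw [mul_one] at this
    rw [this]; congr 2; ring
  have h2 : mtImproper m (a + 1) b m = (m : ℂ) ^ (-(a + b)) * mtImproper 1 (a + 1) b 1 := by
    rw [mtImproper, mtImproper]
    have h := MeasureTheory.integral_comp_mul_left_Ioi' (mtKernel m (a + 1) b) 1 hm
    rw [mul_one] at h
    rw [← h, Complex.real_smul, ← MeasureTheory.integral_const_mul,
      ← MeasureTheory.integral_const_mul]
    refine MeasureTheory.setIntegral_congr_fun measurableSet_Ioi fun v hv => ?_
    have hv0 : (0 : ℝ) < v := one_pos.trans hv
    have := mtKernel_mul hm zero_le_one hv0 (a + 1) b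
    rw [mul_one] at this
    simp only [this]
    rw [← mul_assoc]
    congr 1
    rw [show -(a + b) = 1 + -(a + 1 + b) by ring, Complex.cpow_add _ _ hm', Complex.cpow_one]
  have h3 : (m : ℂ) ^ (1 - a - b) = m * (m : ℂ) ^ (-(a + b)) := by
    rw [show 1 - a - b = 1 + -(a + b) by ring, Complex.cpow_add _ _ hm', Complex.cpow_one]
  rw [mtTailInt, mtTailInt, h1, h2, h3]
  push_cast
  ring

/-! ### Holomorphy in the exponents -/

/-- Cauchy's estimate again converts a majorant of the kernel into one of its derivative, so the
logarithms in the derivative need no bound of their own. -/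
theorem differentiableOn_integral_mtKernel {m : ℝ} (hm : 0 ≤ m) {S : Set ℝ} (hS : MeasurableSet S)
    (hS0 : S ⊆ Set.Ioi 0) {U : Set (ℂ × ℂ)}
    (hb : ∀ x ∈ U, ∃ r > 0, ∃ u : ℝ → ℝ, MeasureTheory.IntegrableOn u S ∧
      ∀ y ∈ Metric.ball x r, ∀ v ∈ S, ‖mtKernel m y.1 y.2 v‖ ≤ u v) :
    DifferentiableOn ℂ (fun p : ℂ × ℂ => ∫ v in S, mtKernel m p.1 p.2 v) U := by
  intro x hx
  obtain ⟨r, hr, u, hu, hbd⟩ := hb x hx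
  set F' : ℂ × ℂ → ℝ → (ℂ × ℂ →L[ℂ] ℂ) := fun p v => mtKernel m p.1 p.2 v •
    (-((Real.log v : ℂ) • ContinuousLinearMap.fst ℂ ℂ ℂ)
      - (Real.log (m + v) : ℂ) • ContinuousLinearMap.snd ℂ ℂ ℂ) with hF'
  have hderiv : ∀ v ∈ S, ∀ p : ℂ × ℂ,
      HasFDerivAt (fun q : ℂ × ℂ => mtKernel m q.1 q.2 v) (F' p v) p := by
    intro v hv p
    have hv0 : 0 < v := hS0 hv
    have hv' : (v : ℂ) ≠ 0 := by exact_mod_cast hv0.ne'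
    have hmv : ((m + v : ℝ) : ℂ) ≠ 0 := by exact_mod_cast (by linarith : 0 < m + v).ne'
    have h1 := (hasFDerivAt_fst (𝕜 := ℂ) (E := ℂ) (F := ℂ) (p := p)).neg.const_cpow
      (c := (v : ℂ)) (Or.inl hv')
    have h2 := (hasFDerivAt_snd (𝕜 := ℂ) (E := ℂ) (F := ℂ) (p := p)).neg.const_cpow
      (c := ((m + v : ℝ) : ℂ)) (Or.inl hmv)
    refine (h1.mul h2).congr_fderiv ?_
    ext <;> simp [F', mtKernel, Complex.ofReal_log hv0.le, Complex.ofReal_log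
      (by linarith : 0 ≤ m + v)] <;> ring
  have hmeas : ∀ p : ℂ × ℂ, MeasureTheory.AEStronglyMeasurable (mtKernel m p.1 p.2)
      (MeasureTheory.volume.restrict S) := fun p =>
    ((continuousOn_mtKernel hm p.1 p.2).mono hS0).aestronglyMeasurable hS
  have hlog : ContinuousOn (fun v : ℝ => (Real.log v : ℂ)) S := fun v hv =>
    (Complex.continuous_ofReal.continuousAt.comp
      (Real.continuousAt_log (hS0 hv).ne')).continuousWithinAt
  have hlog' : ContinuousOn (fun v : ℝ => (Real.log (m + v) : ℂ)) S := fun v hv => by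
    have : m + v ≠ 0 := by have := hS0 hv; simp only [Set.mem_Ioi] at this; linarith
    exact (Complex.continuous_ofReal.continuousAt.comp ((Real.continuousAt_log this).comp
      (continuous_const.add continuous_id).continuousAt)).continuousWithinAt
  refine (hasFDerivAt_integral_of_dominated_of_fderiv_le (𝕜 := ℂ) (F' := F')
    (bound := fun v => 4 * u v / r)
    (Metric.ball_mem_nhds x (half_pos hr)) (Eventually.of_forall hmeas) ?_ ?_ ?_
    ((hu.const_mul 4).div_const r) ?_).differentiableAt.differentiableWithinAt
  · exact MeasureTheory.Integrable.mono' hu (hmeas x) ((MeasureTheory.ae_restrict_iff' hS).2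
      (Eventually.of_forall fun v hv => hbd x (Metric.mem_ball_self hr) v hv))
  · refine ContinuousOn.aestronglyMeasurable ?_ hS
    exact ((continuousOn_mtKernel hm x.1 x.2).mono hS0).smul
      (((hlog.smul continuousOn_const).neg).sub (hlog'.smul continuousOn_const))
  · refine (MeasureTheory.ae_restrict_iff' hS).2 (Eventually.of_forall fun v hv p hp => ?_)
    rw [← (hderiv v hv p).fderiv]
    exact norm_fderiv_le_of_forall_mem_ball_norm_le hr
      (fun q _ => (hderiv v hv q).differentiableAt.differentiableWithinAt)
      (fun q hq => hbd q hq v hv) hp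
  · exact (MeasureTheory.ae_restrict_iff' hS).2
      (Eventually.of_forall fun v hv p _ => hderiv v hv p)

theorem differentiableOn_mtImproper {m N : ℝ} (hm : 0 ≤ m) (hmN : m ≤ N) (hN : 1 ≤ N) :
    DifferentiableOn ℂ (fun p : ℂ × ℂ => mtImproper m p.1 p.2 N) {p | 1 < p.1.re + p.2.re} := by
  refine differentiableOn_integral_mtKernel hm measurableSet_Ioi
    (Set.Ioi_subset_Ioi (by linarith)) fun x hx => ?_
  simp only [Set.mem_ofPred_eq] at hx
  -- Two real parts each move by less than r, so the sum of the exponents stays above 1 + 2r.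
  set r := (x.1.re + x.2.re - 1) / 4 with hr
  have hr0 : 0 < r := by rw [hr]; linarith
  refine ⟨r, hr0, fun v => 2 ^ (|x.2.re| + r) * v ^ (-(x.1.re + x.2.re - 2 * r)),
    (integrableOn_Ioi_rpow_of_lt (by linarith) (by linarith)).const_mul _, fun y hy v hv => ?_⟩
  rw [Metric.mem_ball, Prod.dist_eq, max_lt_iff, dist_eq_norm, dist_eq_norm] at hy
  have h1 := abs_lt.1 ((Complex.abs_re_le_norm _).trans_lt hy.1)
  have h2 := (Complex.abs_re_le_norm _).trans_lt hy.2
  have h3 := abs_lt.1 h2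
  simp only [Complex.sub_re] at h1 h2 h3
  have hv1 : 1 < v := lt_of_le_of_lt hN hv
  refine (norm_mtKernel_le hm (by linarith) (hmN.trans (le_of_lt hv)) _ _).trans ?_
  have h4 : |y.2.re| ≤ |x.2.re| + r := by
    have := abs_add_le (x.2.re) (y.2.re - x.2.re)
    rw [add_sub_cancel] at this
    linarith
  beta_reduce
  gcongr
  · norm_num
  · exact hv1.le
  · linarith

theorem differentiable_mtKernel_exponents {m v : ℝ} (hm : 0 ≤ m) (hv : 0 < v) :
    Differentiable ℂ (fun p : ℂ × ℂ => mtKernel m p.1 p.2 v) := by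
  have hv' : (v : ℂ) ≠ 0 := by exact_mod_cast hv.ne'
  have hmv : ((m + v : ℝ) : ℂ) ≠ 0 := by exact_mod_cast (by linarith : 0 < m + v).ne'
  exact (differentiable_fst.neg.const_cpow (Or.inl hv')).mul
    (differentiable_snd.neg.const_cpow (Or.inl hmv))

theorem rpow_neg_le_exp {v α A : ℝ} (hv : 0 < v) (h : |α| ≤ A) :
    v ^ (-α) ≤ Real.exp (A * |Real.log v|) := by
  rw [Real.rpow_def_of_pos hv, Real.exp_le_exp]
  calc Real.log v * -α ≤ |Real.log v * -α| := le_abs_self _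
    _ = |α| * |Real.log v| := by rw [abs_mul, abs_neg, mul_comm]
    _ ≤ _ := by gcongr

theorem differentiable_mtCellErr {m n : ℝ} (hm : 0 ≤ m) (hn : 0 < n) :
    Differentiable ℂ (fun p : ℂ × ℂ => mtCellErr m p.1 p.2 n) := by
  have h : DifferentiableOn ℂ (fun p : ℂ × ℂ => ∫ v in Set.Ioc n (n + 1), mtKernel m p.1 p.2 v)
      Set.univ := by
    refine differentiableOn_integral_mtKernel hm measurableSet_Ioc
      (fun v hv => hn.trans hv.1) fun x _ => ?_
    refine ⟨1, one_pos, fun v => Real.exp ((‖x.1‖ + 1) * |Real.log v|) *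
      Real.exp ((‖x.2‖ + 1) * |Real.log (m + v)|), ?_, fun y hy v hv => ?_⟩
    · refine (ContinuousOn.integrableOn_compact (isCompact_Icc (a := n) (b := n + 1))
        (fun v hv => ContinuousAt.continuousWithinAt ?_)).mono_set Set.Ioc_subset_Icc_self
      have hv0 : v ≠ 0 := (hn.trans_le hv.1).ne'
      have hv1 : m + v ≠ 0 := by have := hn.trans_le hv.1; linarith
      fun_prop (disch := assumption)
    · rw [Metric.mem_ball, Prod.dist_eq, max_lt_iff, dist_eq_norm, dist_eq_norm] at hy
      have hv0 : 0 < v := hn.trans hv.1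
      rw [norm_mtKernel hm hv0]
      have aux : ∀ a b : ℂ, ‖a - b‖ < 1 → |a.re| ≤ ‖b‖ + 1 := fun a b hab => by
        have h1 := Complex.abs_re_le_norm a
        have h2 := norm_add_le (a - b) b
        rw [sub_add_cancel] at h2
        linarith
      exact mul_le_mul (rpow_neg_le_exp hv0 (aux _ _ hy.1))
        (rpow_neg_le_exp (by linarith) (aux _ _ hy.2)) (by positivity) (by positivity)
  intro p
  refine (differentiable_mtKernel_exponents hm (by linarith) p).sub ?_
  refine ((h.differentiableAt univ_mem).congr_of_eventuallyEq (Eventually.of_forall fun q => ?_))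
  exact intervalIntegral.integral_of_le (by linarith)

theorem differentiableOn_mtTailInt :
    DifferentiableOn ℂ (fun p : ℂ × ℂ => mtTailInt 1 p.1 p.2 1)
      {p | 0 < p.1.re + p.2.re ∧ p.1 + p.2 ≠ 1} := by
  have h0 : Differentiable ℂ (fun p : ℂ × ℂ => mtKernel 1 p.1 (p.2 - 1) 1) :=
    (differentiable_mtKernel_exponents zero_le_one one_pos).comp
      (differentiable_fst.prodMk (differentiable_snd.sub_const 1))
  have h1 : DifferentiableOn ℂ (fun p : ℂ × ℂ => mtImproper 1 (p.1 + 1) p.2 1)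
      {p | 0 < p.1.re + p.2.re ∧ p.1 + p.2 ≠ 1} :=
    (differentiableOn_mtImproper zero_le_one le_rfl le_rfl).comp
      ((differentiable_fst.add_const 1).prodMk differentiable_snd).differentiableOn
      (fun p hp => by simp only [Set.mem_ofPred_eq, Complex.add_re, Complex.one_re]; linarith [hp.1])
  have h2 : Differentiable ℂ (fun p : ℂ × ℂ => p.1 + p.2 - 1) := by fun_prop
  have h3 : ∀ p ∈ {p : ℂ × ℂ | 0 < p.1.re + p.2.re ∧ p.1 + p.2 ≠ 1}, p.1 + p.2 - 1 ≠ 0 :=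
    fun p hp => sub_ne_zero.2 hp.2
  have h4 : Differentiable ℂ (fun p : ℂ × ℂ => p.1 * ((1 : ℝ) : ℂ)) := by fun_prop
  exact ((h0.differentiableOn.sub (h4.differentiableOn.mul h1)).mul
    (h2.differentiableOn.inv h3)).congr fun p _ => div_eq_mul_inv _ _

/-! ### Continued tails and the zeta-function -/

/-- The analytic continuation to `0 < a.re + b.re` of `∑ n > N, n ^ (-a) * (m + n) ^ (-b)`. -/
noncomputable def mtTail (m : ℝ) (a b : ℂ) (N : ℕ) : ℂ :=
  mtTailInt m a b N + ∑' k : ℕ, mtCellErr m a b (N + k)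

theorem norm_mtCellErr_nat_le {m : ℝ} {N : ℕ} (hm : 0 ≤ m) (hmN : m ≤ N) (hN : 1 ≤ N) {a b : ℂ}
    (hab : 0 ≤ a.re + b.re) (k : ℕ) :
    ‖mtCellErr m a b (N + k)‖ ≤
      (‖a‖ + ‖b‖) * 2 ^ |b.re| * ((N : ℝ) + k) ^ (-(a.re + b.re) - 1) := by
  have hk : (0 : ℝ) ≤ k := k.cast_nonneg
  have hN' : (1 : ℝ) ≤ N := by exact_mod_cast hN
  exact norm_mtCellErr_le hm (by linarith) (by linarith) a b hab

theorem summable_mtCellErr {m : ℝ} {N : ℕ} (hm : 0 ≤ m) (hmN : m ≤ N) (hN : 1 ≤ N) {a b : ℂ}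
    (hab : 0 < a.re + b.re) : Summable fun k : ℕ => mtCellErr m a b (N + k) :=
  summable_of_norm_le_rpow_tail hab hN (norm_mtCellErr_nat_le hm hmN hN hab.le)

theorem mtTail_succ {m : ℝ} {N : ℕ} (hm : 0 ≤ m) (hmN : m ≤ N) (hN : 1 ≤ N) {a b : ℂ}
    (hab : 0 < a.re + b.re) (h1 : a + b ≠ 1) :
    mtTail m a b N = mtKernel m a b (N + 1) + mtTail m a b (N + 1) := by
  have hN' : (1 : ℝ) ≤ N := by exact_mod_cast hN
  have h := mtTailInt_sub hm hmN (by linarith) (by linarith : (N : ℝ) ≤ N + 1) hab h1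
  rw [mtTail, mtTail, (summable_mtCellErr hm hmN hN hab).tsum_eq_zero_add]
  have e : ∀ k : ℕ, (N : ℝ) + ((k + 1 : ℕ) : ℝ) = ((N + 1 : ℕ) : ℝ) + k := fun k => by
    push_cast; ring
  simp_rw [e]
  rw [Nat.cast_zero, add_zero, mtCellErr, ← h]
  push_cast
  ring

theorem sum_range_add_mtTail {m : ℝ} {N : ℕ} (hm : 0 ≤ m) (hmN : m ≤ N) (hN : 1 ≤ N) {a b : ℂ}
    (hab : 0 < a.re + b.re) (h1 : a + b ≠ 1) (K : ℕ) :
    ∑ k ∈ Finset.range K, mtKernel m a b (N + k + 1) + mtTail m a b (N + K) = mtTail m a b N := by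
  induction K with
  | zero => simp
  | succ K ih =>
    rw [← ih, Finset.sum_range_succ, mtTail_succ (N := N + K) hm (by push_cast; linarith
      [(Nat.cast_nonneg K : (0 : ℝ) ≤ K)]) (by omega) hab h1]
    push_cast
    rw [← add_assoc N K 1]
    ring

theorem norm_tsum_mtCellErr_le {m : ℝ} {N : ℕ} (hm : 0 ≤ m) (hmN : m ≤ N) (hN : 1 ≤ N) {a b : ℂ}
    (hab : 0 < a.re + b.re) :
    ‖∑' k : ℕ, mtCellErr m a b (N + k)‖ ≤ (‖a‖ + ‖b‖) * 2 ^ |b.re| *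
      (2 ^ (a.re + b.re + 1) / (a.re + b.re)) * (N : ℝ) ^ (-(a.re + b.re)) :=
  norm_tsum_le_rpow_tail hab hN (norm_mtCellErr_nat_le hm hmN hN hab.le)

theorem tendsto_mtTail {m : ℝ} (hm : 0 ≤ m) {a b : ℂ} (hab : 1 < a.re + b.re) :
    Tendsto (fun N : ℕ => mtTail m a b N) atTop (𝓝 0) := by
  set β := a.re + b.re with hβ
  have h1 : Tendsto (fun N : ℕ => 2 ^ |b.re| * (2 + ‖a‖ / β) * (N : ℝ) ^ (-(β - 1)) / ‖a + b - 1‖)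
      atTop (𝓝 0) := by
    have := (((tendsto_rpow_neg_atTop (by linarith : 0 < β - 1)).comp
      tendsto_natCast_atTop_atTop).const_mul (2 ^ |b.re| * (2 + ‖a‖ / β))).div_const ‖a + b - 1‖
    simpa using this
  have h2 : Tendsto (fun N : ℕ => (‖a‖ + ‖b‖) * 2 ^ |b.re| * (2 ^ (β + 1) / β) * (N : ℝ) ^ (-β))
      atTop (𝓝 0) := by
    have := ((tendsto_rpow_neg_atTop (by linarith : 0 < β)).comp
      tendsto_natCast_atTop_atTop).const_mul ((‖a‖ + ‖b‖) * 2 ^ |b.re| * (2 ^ (β + 1) / β))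
    simpa using this
  refine squeeze_zero_norm' ?_ (by simpa using h1.add h2)
  filter_upwards [eventually_ge_atTop (max 1 ⌈m⌉₊)] with N hN
  have hN1 : 1 ≤ N := (le_max_left _ _).trans hN
  have hmN : m ≤ N := Nat.ceil_le.1 ((le_max_right _ _).trans hN)
  have hN' : (1 : ℝ) ≤ N := by exact_mod_cast hN1
  refine (norm_add_le _ _).trans (add_le_add ?_ ?_)
  · simpa using norm_mtTailInt_le hm hmN (by linarith) (a := a) (b := b) (by linarith)
  · exact norm_tsum_mtCellErr_le hm hmN hN1 (by linarith)

theorem add_ne_one_of_one_lt_re {a b : ℂ} (hab : 1 < a.re + b.re) : a + b ≠ 1 := fun h => by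
  have := congrArg Complex.re h
  simp only [Complex.add_re, Complex.one_re] at this
  linarith

/-- The continued tail shifts by single terms and tends to 0 at infinity, so the partial sums
converge to it. -/
theorem hasSum_mtTail {m : ℝ} {N : ℕ} (hm : 0 ≤ m) (hmN : m ≤ N) (hN : 1 ≤ N) {a b : ℂ}
    (hab : 1 < a.re + b.re) :
    HasSum (fun k : ℕ => mtKernel m a b (N + k + 1)) (mtTail m a b N) := by
  have hs : Summable fun k : ℕ => mtKernel m a b (N + k + 1) := by
    refine summable_of_norm_le_rpow_tail (α := a.re + b.re - 1) (C := 2 ^ |b.re|) (by linarith) hN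
      fun k => ?_
    have hk : (0 : ℝ) ≤ k := k.cast_nonneg
    have hN' : (1 : ℝ) ≤ N := by exact_mod_cast hN
    refine (norm_mtKernel_le hm (by positivity) (by linarith) a b).trans ?_
    rw [show -(a.re + b.re - 1) - 1 = -(a.re + b.re) by ring]
    exact mul_le_mul_of_nonneg_left (Real.rpow_le_rpow_of_nonpos (by linarith) (by linarith)
      (by linarith)) (by positivity)
  rw [hs.hasSum_iff_tendsto_nat]
  have h := sum_range_add_mtTail hm hmN hN (by linarith : 0 < a.re + b.re)
    (add_ne_one_of_one_lt_re hab)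
  have e : (fun K => ∑ k ∈ Finset.range K, mtKernel m a b (N + k + 1))
      = fun K => mtTail m a b N - mtTail m a b (K + N) := by
    funext K; rw [← h K, add_comm K N]; ring
  rw [e]
  simpa using (((tendsto_add_atTop_iff_nat N).2 (tendsto_mtTail hm hab)).const_sub
    (mtTail m a b N))

theorem mtKernel_zero_left {v : ℝ} (z : ℂ) : mtKernel 0 z 0 v = (v : ℂ) ^ (-z) := by
  simp [mtKernel]

/-- The Riemann zeta-function in the half plane `0 < z.re`. -/
noncomputable def zetaRight (z : ℂ) : ℂ := 1 + mtTail 0 z 0 1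

theorem hasSum_zetaRight {z : ℂ} (hz : 1 < z.re) :
    HasSum (fun k : ℕ => (((k + 1 : ℕ) : ℝ) : ℂ) ^ (-z)) (zetaRight z) := by
  have h := hasSum_mtTail (m := 0) (N := 1) le_rfl (by simp) le_rfl (a := z) (b := 0) (by simpa)
  simp only [mtKernel_zero_left] at h
  have h2 := (hasSum_nat_add_iff (f := fun k : ℕ => (((k + 1 : ℕ) : ℝ) : ℂ) ^ (-z))
    (g := mtTail 0 z 0 1) 1).1 (by convert! h using 4; push_cast; ring)
  simpa [zetaRight, add_comm] using h2

theorem differentiableOn_zetaRight : DifferentiableOn ℂ zetaRight {z | 0 < z.re ∧ z ≠ 1} := by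
  have hopen : IsOpen {z : ℂ | 0 < z.re ∧ z ≠ 1} :=
    (isOpen_lt continuous_const Complex.continuous_re).inter isOpen_ne
  have h1 : DifferentiableOn ℂ (fun z => mtTailInt 0 z 0 ((1 : ℕ) : ℝ)) {z | 0 < z.re ∧ z ≠ 1} := by
    have : (fun z => mtTailInt 0 z 0 ((1 : ℕ) : ℝ)) = fun z : ℂ => 1 / (z - 1) := by
      funext z; simp [mtTailInt, mtKernel]
    rw [this]
    exact (differentiableOn_const _).div (Differentiable.differentiableOn (by fun_prop))
      fun z hz => sub_ne_zero.2 hz.2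
  have h2 : DifferentiableOn ℂ (fun z => ∑' k : ℕ, mtCellErr 0 z 0 ((1 : ℕ) + k))
      {z | 0 < z.re ∧ z ≠ 1} := by
    refine differentiableOn_tsum_of_locally_norm_le hopen (fun k => ?_) fun x hx => ?_
    · refine ((differentiable_mtCellErr (m := 0) (n := (1 : ℕ) + k) le_rfl (by positivity)).comp
        (f := fun z : ℂ => (z, (0 : ℂ))) (by fun_prop)).differentiableOn
    · have hx0 : 0 < x.re := hx.1
      refine ⟨x.re / 2, by linarith, fun k : ℕ => (‖x‖ + x.re) *
        (((1 : ℕ) : ℝ) + k) ^ (-(x.re / 2) - 1),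
        (summable_rpow_tail (by linarith) le_rfl).mul_left _, fun y hy k => ?_⟩
      rw [Metric.mem_ball, dist_eq_norm] at hy
      have h3 := abs_lt.1 ((Complex.abs_re_le_norm _).trans_lt hy)
      rw [Complex.sub_re] at h3
      have h4 : ‖y‖ ≤ ‖x‖ + x.re := by
        have := norm_add_le (y - x) x
        rw [sub_add_cancel] at this
        linarith
      refine (norm_mtCellErr_nat_le (m := 0) (N := 1) le_rfl (by simp) le_rfl (a := y) (b := 0)
        (by simp; linarith) k).trans ?_
      simp only [norm_zero, add_zero, Complex.zero_re, abs_zero, Real.rpow_zero, mul_one]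
      have hk : (0 : ℝ) ≤ k := k.cast_nonneg
      gcongr
      · simp
      · linarith
  exact ((h1.add h2).const_add 1).congr fun z _ => rfl

/-! ### Continuation of the double series -/

/-- The remainder terms of the sum over the cone `m < n`, indexed by `(m - 1, n - 1 - m)`. -/
noncomputable def mtConeErr (s : ℂ × ℂ × ℂ) (p : ℕ × ℕ) : ℂ :=
  ((p.1 + 1 : ℕ) : ℂ) ^ (-s.1) *
    mtCellErr (p.1 + 1 : ℕ) s.2.1 s.2.2 ((p.1 + 1 : ℕ) + p.2)

/-- The continuation of the part `m < n` of the Mordell–Tornheim double series. -/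
noncomputable def mtCone (s : ℂ × ℂ × ℂ) : ℂ :=
  mtTailInt 1 s.2.1 s.2.2 1 * zetaRight (s.1 + s.2.1 + s.2.2 - 1) + ∑' p, mtConeErr s p

theorem norm_mtConeErr_le (s : ℂ × ℂ × ℂ) (hs : 0 ≤ s.2.1.re + s.2.2.re) (p : ℕ × ℕ) :
    ‖mtConeErr s p‖ ≤ (‖s.2.1‖ + ‖s.2.2‖) * 2 ^ |s.2.2.re| * (((p.1 : ℝ) + 1) ^ (-s.1.re) *
      ((p.1 : ℝ) + 1 + p.2) ^ (-(s.2.1.re + s.2.2.re + 1))) := by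
  have h := norm_mtCellErr_nat_le (m := (p.1 + 1 : ℕ)) (N := p.1 + 1) (by positivity) le_rfl
    (by omega) hs p.2
  rw [mtConeErr, norm_mul, Complex.norm_natCast_cpow_of_pos (by omega), Complex.neg_re]
  calc _ ≤ ((p.1 + 1 : ℕ) : ℝ) ^ (-s.1.re) * _ := mul_le_mul_of_nonneg_left h (by positivity)
    _ = _ := by push_cast; rw [neg_add _ (1 : ℝ), ← sub_eq_add_neg]; ring

theorem summable_mtConeErr {s : ℂ × ℂ × ℂ} (h1 : 0 < s.2.1.re + s.2.2.re)
    (h2 : 1 < s.1.re + s.2.1.re + s.2.2.re) : Summable (mtConeErr s) :=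
  ((summable_rpow_cone (a := s.1.re) (b := s.2.1.re + s.2.2.re + 1) (by linarith)
    (by linarith)).mul_left _).of_norm_bounded (norm_mtConeErr_le s h1.le)

theorem differentiableOn_mtCone : DifferentiableOn ℂ mtCone
    {s | 0 < s.2.1.re + s.2.2.re ∧ 1 < s.1.re + s.2.1.re + s.2.2.re ∧ s.2.1 + s.2.2 ≠ 1 ∧
      s.1 + s.2.1 + s.2.2 ≠ 2} := by
  set V : Set (ℂ × ℂ × ℂ) := {s | 0 < s.2.1.re + s.2.2.re ∧ 1 < s.1.re + s.2.1.re + s.2.2.re ∧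
    s.2.1 + s.2.2 ≠ 1 ∧ s.1 + s.2.1 + s.2.2 ≠ 2} with hV
  have hopen : IsOpen V := by
    refine IsOpen.and ?_ (IsOpen.and ?_ (IsOpen.and ?_ ?_))
    · exact isOpen_lt (by fun_prop) (by fun_prop)
    · exact isOpen_lt (by fun_prop) (by fun_prop)
    · exact isOpen_ne_fun (by fun_prop) (by fun_prop)
    · exact isOpen_ne_fun (by fun_prop) (by fun_prop)
  have h1 : DifferentiableOn ℂ (fun s : ℂ × ℂ × ℂ => mtTailInt 1 s.2.1 s.2.2 1) V :=
    differentiableOn_mtTailInt.comp (f := fun s : ℂ × ℂ × ℂ => s.2)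
      differentiable_snd.differentiableOn fun s hs => ⟨hs.1, hs.2.2.1⟩
  have h2 : DifferentiableOn ℂ (fun s : ℂ × ℂ × ℂ => zetaRight (s.1 + s.2.1 + s.2.2 - 1)) V := by
    refine differentiableOn_zetaRight.comp (f := fun s : ℂ × ℂ × ℂ => s.1 + s.2.1 + s.2.2 - 1)
      (Differentiable.differentiableOn (by fun_prop)) fun s hs => ⟨?_, fun h => hs.2.2.2 ?_⟩
    · have := hs.2.1
      simp only [Complex.add_re, Complex.sub_re, Complex.one_re]; linarith
    · linear_combination h
  have h3 : DifferentiableOn ℂ (fun s : ℂ × ℂ × ℂ => ∑' p, mtConeErr s p) V := by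
    refine differentiableOn_tsum_of_locally_norm_le (F := fun p s => mtConeErr s p) hopen
      (fun p => ?_) fun x hx => ?_
    · have hc : ((p.1 + 1 : ℕ) : ℂ) ≠ 0 := by exact_mod_cast (Nat.succ_ne_zero p.1)
      exact ((differentiable_fst.neg.const_cpow (Or.inl hc)).mul ((differentiable_mtCellErr
        (m := (p.1 + 1 : ℕ)) (n := (p.1 + 1 : ℕ) + p.2) (by positivity) (by positivity)).comp
        (f := fun s : ℂ × ℂ × ℂ => s.2) differentiable_snd)).differentiableOn
    · obtain ⟨hx1, hx2, -, -⟩ := hx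
      -- The two open conditions involve two and three real parts, each moving by less than r; this
      -- leaves room for `summable_rpow_cone` with the worst exponents.
      obtain ⟨r, hr, hr1, hr2⟩ : ∃ r : ℝ, 0 < r ∧ 2 * r < x.2.1.re + x.2.2.re ∧
          3 * r < x.1.re + x.2.1.re + x.2.2.re - 1 := by
        have h : 0 < min (x.2.1.re + x.2.2.re) (x.1.re + x.2.1.re + x.2.2.re - 1) :=
          lt_min hx1 (by linarith)
        refine ⟨min (x.2.1.re + x.2.2.re) (x.1.re + x.2.1.re + x.2.2.re - 1) / 4,
          by linarith, ?_, ?_⟩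
        · linarith [min_le_left (x.2.1.re + x.2.2.re) (x.1.re + x.2.1.re + x.2.2.re - 1)]
        · linarith [min_le_right (x.2.1.re + x.2.2.re) (x.1.re + x.2.1.re + x.2.2.re - 1)]
      refine ⟨r, hr, fun p => ((‖x.2.1‖ + r) + (‖x.2.2‖ + r)) * 2 ^ (|x.2.2.re| + r) *
        (((p.1 : ℝ) + 1) ^ (-(x.1.re - r)) *
        ((p.1 : ℝ) + 1 + p.2) ^ (-(x.2.1.re + x.2.2.re - 2 * r + 1))),
        (summable_rpow_cone (by linarith) (by linarith)).mul_left _, fun y hy p => ?_⟩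
      rw [Metric.mem_ball, Prod.dist_eq, max_lt_iff, Prod.dist_eq, max_lt_iff, dist_eq_norm,
        dist_eq_norm, dist_eq_norm] at hy
      have g1 := abs_lt.1 ((Complex.abs_re_le_norm _).trans_lt hy.1)
      have g2 := abs_lt.1 ((Complex.abs_re_le_norm _).trans_lt hy.2.1)
      have g3' := (Complex.abs_re_le_norm _).trans_lt hy.2.2
      have g3 := abs_lt.1 g3'
      simp only [Complex.sub_re] at g1 g2 g3 g3'
      have n2 : ‖y.2.1‖ ≤ ‖x.2.1‖ + r := by
        have := norm_add_le (y.2.1 - x.2.1) x.2.1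
        rw [sub_add_cancel] at this
        linarith [hy.2.1]
      have n3 : ‖y.2.2‖ ≤ ‖x.2.2‖ + r := by
        have := norm_add_le (y.2.2 - x.2.2) x.2.2
        rw [sub_add_cancel] at this
        linarith [hy.2.2]
      have n4 : |y.2.2.re| ≤ |x.2.2.re| + r := by
        have := abs_add_le (y.2.2.re - x.2.2.re) x.2.2.re
        rw [sub_add_cancel] at this
        linarith
      have q1 : (0 : ℝ) ≤ p.1 := p.1.cast_nonneg
      have q2 : (0 : ℝ) ≤ p.2 := p.2.cast_nonneg
      refine (norm_mtConeErr_le y (by linarith) p).trans ?_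
      beta_reduce
      gcongr
      · norm_num
      · linarith
      · linarith
      · linarith
      · linarith
  exact (h1.mul h2).add h3

theorem mtTerm_eq (s : ℂ × ℂ × ℂ) (m n : ℕ) :
    mtTerm s m n = (m : ℂ) ^ (-s.1) * mtKernel m s.2.1 s.2.2 n := by
  rw [mtTerm, mtKernel, Complex.cpow_neg, Complex.cpow_neg, Complex.cpow_neg]
  push_cast
  rw [one_div, mul_inv, mul_inv, mul_assoc]

theorem mtTerm_swap (a b c : ℂ) (m n : ℕ) : mtTerm (a, b, c) m n = mtTerm (b, a, c) n m := by
  simp only [mtTerm]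
  rw [add_comm (m : ℂ), mul_comm ((m : ℂ) ^ a)]

theorem summable_mtTerm_cone {s : ℂ × ℂ × ℂ} (h1 : 1 < s.2.1.re + s.2.2.re)
    (h2 : 2 < s.1.re + s.2.1.re + s.2.2.re) :
    Summable fun p : ℕ × ℕ => mtTerm s (p.1 + 1) (p.1 + 1 + p.2 + 1) := by
  refine ((summable_rpow_cone (a := s.1.re) (b := s.2.1.re + s.2.2.re) h1
    (by linarith)).mul_left (2 ^ |s.2.2.re|)).of_norm_bounded fun p => ?_
  have q1 : (0 : ℝ) ≤ p.1 := p.1.cast_nonneg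
  have q2 : (0 : ℝ) ≤ p.2 := p.2.cast_nonneg
  rw [mtTerm_eq, norm_mul, Complex.norm_natCast_cpow_of_pos (by omega), Complex.neg_re]
  have h := norm_mtKernel_le (m := (p.1 + 1 : ℕ)) (v := (p.1 + 1 + p.2 + 1 : ℕ)) (by positivity)
    (by positivity) (by push_cast; linarith) s.2.1 s.2.2
  have h3 : ((p.1 + 1 + p.2 + 1 : ℕ) : ℝ) ^ (-(s.2.1.re + s.2.2.re))
      ≤ ((p.1 : ℝ) + 1 + p.2) ^ (-(s.2.1.re + s.2.2.re)) :=
    Real.rpow_le_rpow_of_nonpos (by positivity) (by push_cast; linarith) (by linarith)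
  calc _ ≤ ((p.1 + 1 : ℕ) : ℝ) ^ (-s.1.re) *
        (2 ^ |s.2.2.re| * ((p.1 : ℝ) + 1 + p.2) ^ (-(s.2.1.re + s.2.2.re))) := by
        refine mul_le_mul_of_nonneg_left (h.trans ?_) (by positivity)
        gcongr
    _ = _ := by push_cast; ring

theorem cpow_mul_mtTailInt_self (s : ℂ × ℂ × ℂ) (m : ℕ) (hm : 0 < m) :
    (m : ℂ) ^ (-s.1) * mtTailInt m s.2.1 s.2.2 m
      = mtTailInt 1 s.2.1 s.2.2 1 * ((m : ℝ) : ℂ) ^ (-(s.1 + s.2.1 + s.2.2 - 1)) := by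
  have hm' : (m : ℂ) ≠ 0 := by exact_mod_cast hm.ne'
  rw [mtTailInt_self (by exact_mod_cast hm), Complex.ofReal_natCast, ← mul_assoc,
    ← Complex.cpow_add _ _ hm', mul_comm]
  congr 2
  ring

/-- Summed by rows: row m is m^(-s₁) times a tail starting at m, whose integral part is a term of
the series of ζ(s₁+s₂+s₃-1) and whose cell errors form row m of `mtConeErr`. -/
theorem hasSum_mtCone {s : ℂ × ℂ × ℂ} (h1 : 1 < s.2.1.re + s.2.2.re)
    (h2 : 2 < s.1.re + s.2.1.re + s.2.2.re) :
    HasSum (fun p : ℕ × ℕ => mtTerm s (p.1 + 1) (p.1 + 1 + p.2 + 1)) (mtCone s) := by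
  have hs := summable_mtTerm_cone h1 h2
  have hse := summable_mtConeErr (s := s) (by linarith) (by linarith)
  have hrow : ∀ m : ℕ, HasSum (fun k : ℕ => mtTerm s (m + 1) (m + 1 + k + 1))
      (((m + 1 : ℕ) : ℂ) ^ (-s.1) * mtTail (m + 1 : ℕ) s.2.1 s.2.2 (m + 1)) := fun m => by
    have h := (hasSum_mtTail (m := (m + 1 : ℕ)) (N := m + 1) (by positivity) le_rfl (by omega)
      h1).mul_left (((m + 1 : ℕ) : ℂ) ^ (-s.1))
    simp_rw [mtTerm_eq]
    convert! h using 5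
    push_cast; ring
  have hz := (hasSum_zetaRight (z := s.1 + s.2.1 + s.2.2 - 1) (by
    simp only [Complex.add_re, Complex.sub_re, Complex.one_re]; linarith)).mul_left
    (mtTailInt 1 s.2.1 s.2.2 1)
  have herow : HasSum (fun m : ℕ => ∑' k : ℕ, mtConeErr s (m, k)) (∑' p, mtConeErr s p) :=
    hse.hasSum.prod_fiberwise fun m => (hse.prod_factor m).hasSum
  have htot := hz.add herow
  have hfib := hs.hasSum.prod_fiberwise hrow
  rw [hs.hasSum_iff, mtCone, ← htot.tsum_eq, ← hfib.tsum_eq]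
  congr 1
  funext m
  rw [mtTail, mul_add, cpow_mul_mtTailInt_self s (m + 1) (by omega), ← tsum_mul_left]
  rfl

theorem mtTerm_diag (s : ℂ × ℂ × ℂ) (m : ℕ) (hm : 0 < m) : mtTerm s m m
    = 2 ^ (-s.2.2) * ((m : ℝ) : ℂ) ^ (-(s.1 + s.2.1 + s.2.2)) := by
  have hm' : (m : ℂ) ≠ 0 := by exact_mod_cast hm.ne'
  have h2 : (((m : ℝ) + m : ℝ) : ℂ) ^ (-s.2.2) = 2 ^ (-s.2.2) * (m : ℂ) ^ (-s.2.2) := by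
    have := Complex.mul_cpow_ofReal_nonneg (a := 2) (b := m) (by norm_num) (by positivity) (-s.2.2)
    push_cast at this ⊢
    rw [← this, two_mul]
  rw [mtTerm_eq, mtKernel, h2, neg_add, neg_add, Complex.ofReal_natCast,
    Complex.cpow_add _ _ hm', Complex.cpow_add _ _ hm']
  ring

theorem hasSum_diag {s : ℂ × ℂ × ℂ} (h : 1 < s.1.re + s.2.1.re + s.2.2.re) :
    HasSum (fun m : ℕ => mtTerm s (m + 1) (m + 1))
      (2 ^ (-s.2.2) * zetaRight (s.1 + s.2.1 + s.2.2)) := by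
  have hz := (hasSum_zetaRight (z := s.1 + s.2.1 + s.2.2) (by
    simp only [Complex.add_re]; linarith)).mul_left ((2 : ℂ) ^ (-s.2.2))
  convert! hz using 2 with m
  exact mtTerm_diag s (m + 1) (by omega)

/-- The continuation of the Mordell–Tornheim double series: the parts `m < n`, `n < m`, `m = n`. -/
noncomputable def mtExplicit (s : ℂ × ℂ × ℂ) : ℂ :=
  mtCone s + mtCone (s.2.1, s.1, s.2.2) + 2 ^ (-s.2.2) * zetaRight (s.1 + s.2.1 + s.2.2)

theorem hasSum_pnat_prod {f : ℕ → ℕ → ℂ} {a b c : ℂ}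
    (ha : HasSum (fun p : ℕ × ℕ => f (p.1 + 1) (p.1 + 1 + p.2 + 1)) a)
    (hb : HasSum (fun p : ℕ × ℕ => f (p.1 + 1 + p.2 + 1) (p.1 + 1)) b)
    (hc : HasSum (fun m : ℕ => f (m + 1) (m + 1)) c) :
    HasSum (fun p : ℕ+ × ℕ+ => f p.1 p.2) (a + b + c) := by
  set g : ℕ+ × ℕ+ → ℂ := fun p => f p.1 p.2 with hg
  set ia : ℕ × ℕ → ℕ+ × ℕ+ := fun p => (p.1.succPNat, (p.1 + 1 + p.2).succPNat) with hia
  set ib : ℕ × ℕ → ℕ+ × ℕ+ := fun p => ((p.1 + 1 + p.2).succPNat, p.1.succPNat) with hib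
  set ic : ℕ → ℕ+ × ℕ+ := fun m => (m.succPNat, m.succPNat) with hic
  have ja : Function.Injective ia := by
    rintro ⟨x, y⟩ ⟨x', y'⟩ h
    simp only [hia, Prod.mk.injEq, Nat.succPNat_inj] at h
    ext <;> simp only <;> omega
  have jb : Function.Injective ib := by
    rintro ⟨x, y⟩ ⟨x', y'⟩ h
    simp only [hib, Prod.mk.injEq, Nat.succPNat_inj] at h
    ext <;> simp only <;> omega
  have jc : Function.Injective ic := by
    intro x x' h
    simp only [hic, Prod.mk.injEq, Nat.succPNat_inj] at h
    exact h.1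
  have ra : Set.range ia = {p | p.1 < p.2} := by
    ext ⟨x, y⟩
    simp only [Set.mem_range, hia, Prod.mk.injEq, Set.mem_ofPred_eq, Prod.exists,
      ← PNat.coe_inj, ← PNat.coe_lt_coe, Nat.succPNat_coe]
    have := x.pos
    constructor
    · rintro ⟨u, v, h⟩; omega
    · intro h; exact ⟨x - 1, y - x - 1, by omega, by omega⟩
  have rb : Set.range ib = {p | p.2 < p.1} := by
    ext ⟨x, y⟩
    simp only [Set.mem_range, hib, Prod.mk.injEq, Set.mem_ofPred_eq, Prod.exists,
      ← PNat.coe_inj, ← PNat.coe_lt_coe, Nat.succPNat_coe]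
    have := y.pos
    constructor
    · rintro ⟨u, v, h⟩; omega
    · intro h; exact ⟨y - 1, x - y - 1, by omega, by omega⟩
  have rc : Set.range ic = {p | p.1 = p.2} := by
    ext ⟨x, y⟩
    simp only [Set.mem_range, hic, Prod.mk.injEq, Set.mem_ofPred_eq,
      ← PNat.coe_inj, Nat.succPNat_coe]
    have := y.pos
    constructor
    · rintro ⟨u, h⟩; omega
    · intro h; exact ⟨x - 1, by omega, by omega⟩
  have ha' := ja.hasSum_range_iff (f := g) |>.2 ha
  have hb' := jb.hasSum_range_iff (f := g) |>.2 hb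
  have hc' := jc.hasSum_range_iff (f := g) |>.2 hc
  have dab : Disjoint (Set.range ia) (Set.range ib) := by
    rw [ra, rb, Set.disjoint_left]
    exact fun p (h : p.1 < p.2) (h' : p.2 < p.1) => lt_asymm h h'
  have dabc : Disjoint (Set.range ia ∪ Set.range ib) (Set.range ic) := by
    rw [ra, rb, rc, Set.disjoint_left]
    rintro p (h | h) h'
    · exact (show p.1 < p.2 from h).ne h'
    · exact (show p.2 < p.1 from h).ne' h'
  have hab : HasSum (g ∘ ((↑) : ↥(Set.range ia ∪ Set.range ib) → ℕ+ × ℕ+)) (a + b) :=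
    HasSum.add_disjoint (f := g) dab ha' hb'
  have h := HasSum.add_disjoint (f := g) dabc hab hc'
  have huniv : Set.range ia ∪ Set.range ib ∪ Set.range ic = Set.univ := by
    rw [ra, rb, rc, Set.eq_univ_iff_forall]
    intro p
    rcases lt_trichotomy p.1 p.2 with h | h | h
    · exact Or.inl (Or.inl h)
    · exact Or.inr h
    · exact Or.inl (Or.inr h)
  rw [huniv] at h
  exact (hasSum_subtype_iff_of_support_subset (Set.subset_univ _)).1 h

theorem isMTContinuation_mtExplicit : IsMTContinuation mtExplicit := by
  constructor
  · have h1 : DifferentiableOn ℂ mtCone mtHolomorphyDomain := differentiableOn_mtCone.mono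
      fun s ⟨_, h2, h3, _, h5, h6⟩ => ⟨by linarith, by linarith, h5, h6⟩
    have h2 : DifferentiableOn ℂ (fun s : ℂ × ℂ × ℂ => mtCone (s.2.1, s.1, s.2.2))
        mtHolomorphyDomain := by
      refine differentiableOn_mtCone.comp (f := fun s : ℂ × ℂ × ℂ => (s.2.1, s.1, s.2.2))
        (Differentiable.differentiableOn (by fun_prop)) fun s ⟨h1, h2, h3, h4, h5, h6⟩ =>
        ⟨?_, ?_, h4, ?_⟩
      · simp only; linarith
      · simp only; linarith
      · simp only; rwa [add_comm s.2.1]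
    have h3 : DifferentiableOn ℂ (fun s : ℂ × ℂ × ℂ => zetaRight (s.1 + s.2.1 + s.2.2))
        mtHolomorphyDomain := by
      refine differentiableOn_zetaRight.comp (f := fun s : ℂ × ℂ × ℂ => s.1 + s.2.1 + s.2.2)
        (Differentiable.differentiableOn (by fun_prop)) fun s ⟨_, _, h3, _⟩ => ⟨?_, fun h => ?_⟩
      · simp only [Complex.add_re]; linarith
      · have := congrArg Complex.re h
        simp only [Complex.add_re, Complex.one_re] at this
        linarith
    have h4 : Differentiable ℂ (fun s : ℂ × ℂ × ℂ => (2 : ℂ) ^ (-s.2.2)) :=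
      (differentiable_snd.comp differentiable_snd).neg.const_cpow (Or.inl two_ne_zero)
    exact (h1.add h2).add (h4.differentiableOn.mul h3)
  · rintro ⟨a, b, c⟩ ⟨h1, h2, h3⟩
    simp only at h1 h2 h3
    refine hasSum_pnat_prod (f := mtTerm (a, b, c)) (hasSum_mtCone h2 h3) ?_
      (hasSum_diag (by simp only; linarith))
    have := hasSum_mtCone (s := (b, a, c)) h1 (by simp only; linarith)
    simpa only [mtTerm_swap a b c] using this

/-! ### Identification of the continuation -/

theorem isMTContinuation_mordellTornheimZeta : IsMTContinuation mordellTornheimZeta := by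
  have h : ∃ F : ℂ × ℂ × ℂ → ℂ, IsMTContinuation F := ⟨_, isMTContinuation_mtExplicit⟩
  rw [mordellTornheimZeta, dif_pos h]
  exact h.choose_spec

/-- With the first two variables frozen, the one-variable identity theorem on a convex part of the
upper half plane suffices: positive imaginary parts keep clear of the singular hyperplanes, so
connectedness of the full domain is not needed. -/
theorem IsMTContinuation.eq_of_im_pos {F G : ℂ × ℂ × ℂ → ℂ} (hF : IsMTContinuation F)
    (hG : IsMTContinuation G) {a b c : ℂ} (ha : 0 ≤ a.im) (hb : 0 ≤ b.im) (hc : 0 < c.im)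
    (h1 : 1 / 2 < a.re + c.re) (h2 : 1 / 2 < b.re + c.re) (h3 : 3 / 2 < a.re + b.re + c.re) :
    F (a, b, c) = G (a, b, c) := by
  set U : Set ℂ := (({z | 0 < z.im} ∩ {z | 1 / 2 - a.re < z.re}) ∩ {z | 1 / 2 - b.re < z.re}) ∩
    {z | 3 / 2 - a.re - b.re < z.re} with hU
  have hopen : IsOpen U :=
    (((isOpen_lt continuous_const Complex.continuous_im).inter
      (isOpen_lt continuous_const Complex.continuous_re)).inter
      (isOpen_lt continuous_const Complex.continuous_re)).inter
      (isOpen_lt continuous_const Complex.continuous_re)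
  have hconv : Convex ℝ U :=
    (((convex_halfSpace_im_gt _).inter (convex_halfSpace_re_gt _)).inter
      (convex_halfSpace_re_gt _)).inter (convex_halfSpace_re_gt _)
  have hmaps : ∀ z ∈ U, (a, b, z) ∈ mtHolomorphyDomain := by
    rintro z ⟨⟨⟨g0, g1⟩, g2⟩, g3⟩
    simp only [Set.mem_ofPred_eq] at g0 g1 g2 g3
    refine ⟨?_, ?_, ?_, fun h => ?_, fun h => ?_, fun h => ?_⟩
    · simp only; linarith
    · simp only; linarith
    · simp only; linarith
    all_goals
      have := congrArg Complex.im h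
      simp at this
      linarith
  have han : ∀ {H : ℂ × ℂ × ℂ → ℂ}, IsMTContinuation H →
      AnalyticOnNhd ℂ (fun z => H (a, b, z)) U := fun hH =>
    (hH.1.comp (f := fun z : ℂ => (a, b, z)) (Differentiable.differentiableOn (by fun_prop))
      hmaps).analyticOnNhd hopen
  set K : ℝ := 3 + |a.re| + |b.re| + |c.re| with hK
  have ka := neg_abs_le a.re
  have kb := neg_abs_le b.re
  have kc := neg_abs_le c.re
  have ka' := abs_nonneg a.re
  have kb' := abs_nonneg b.re
  -- A real translation by K reaches the domain of absolute convergence, where a neighbourhood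
  -- carries the same series for both functions.
  have hz0 : c + K ∈ U := by
    refine ⟨⟨⟨?_, ?_⟩, ?_⟩, ?_⟩ <;> simp only [Set.mem_ofPred_eq, Complex.add_re, Complex.add_im,
      Complex.ofReal_re, Complex.ofReal_im] <;> linarith [abs_nonneg c.re]
  refine (han hF).eqOn_of_preconnected_of_eventuallyEq (han hG) hconv.isPreconnected hz0 ?_
    (show c ∈ U from ⟨⟨⟨hc, ?_⟩, ?_⟩, ?_⟩)
  · have hev : ∀ᶠ z : ℂ in 𝓝 (c + K), (c + K).re - 1 / 2 < z.re :=
      (isOpen_lt continuous_const Complex.continuous_re).mem_nhds (by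
        simp only [Set.mem_ofPred_eq]; linarith)
    filter_upwards [hev] with z hz
    simp only [Complex.add_re, Complex.ofReal_re] at hz
    have hmem : (a, b, z) ∈ mtConvergenceDomain := by
      refine ⟨?_, ?_, ?_⟩ <;> simp only <;> linarith
    exact (hF.2 _ hmem).unique (hG.2 _ hmem)
  · simp only [Set.mem_ofPred_eq]; linarith
  · simp only [Set.mem_ofPred_eq]; linarith
  · simp only [Set.mem_ofPred_eq]; linarith

/-! ### Kusmin–Landau telescoping for the zeta cell errors -/

/-- The function `1 / (exp z - 1) - 1 / z`, which has a removable singularity at `0`. -/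
noncomputable def expPole (z : ℂ) : ℂ := 1 / (Complex.exp z - 1) - 1 / z

theorem exp_ne_one_of_abs_im_lt {z : ℂ} (hz : z ≠ 0) (h : |z.im| < 2 * Real.pi) :
    Complex.exp z ≠ 1 := by
  intro he
  obtain ⟨n, hn⟩ := Complex.exp_eq_one_iff.1 he
  have him : z.im = n * (2 * Real.pi) := by rw [hn]; simp
  rw [him, abs_mul, abs_of_pos Real.two_pi_pos] at h
  have h1 : |(n : ℝ)| < 1 := by
    by_contra h2
    nlinarith [Real.two_pi_pos, not_lt.1 h2]
  have h2 : n = 0 := by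
    have : |n| < 1 := by exact_mod_cast h1
    exact Int.abs_lt_one_iff.1 this
  apply hz
  rw [hn, h2]
  simp

/-- Let g(z) = (e^z - 1)/z with g(0) = 1. It has no zero in the strip, and `expPole` is the
difference quotient of 1/g at 0, hence two applications of `dslope`. -/
theorem exists_differentiableOn_eq_expPole : ∃ f : ℂ → ℂ,
    DifferentiableOn ℂ f {z | |z.im| < 2 * Real.pi} ∧
    ∀ z, z ≠ 0 → |z.im| < 2 * Real.pi → f z = expPole z := by
  set S : Set ℂ := {z | |z.im| < 2 * Real.pi} with hS
  have hopen : IsOpen S := isOpen_lt (by fun_prop) continuous_const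
  have h0 : S ∈ 𝓝 (0 : ℂ) := hopen.mem_nhds (by simp [hS, Real.pi_pos])
  have hne : ∀ z ∈ S, dslope Complex.exp 0 z ≠ 0 := by
    intro z hz
    rcases eq_or_ne z 0 with rfl | hz0
    · simp [dslope_same]
    · rw [dslope_of_ne _ hz0, slope_def_field, Complex.exp_zero, sub_zero]
      exact div_ne_zero (sub_ne_zero.2 (exp_ne_one_of_abs_im_lt hz0 hz)) hz0
  have h1 : DifferentiableOn ℂ (dslope Complex.exp 0) S :=
    (Complex.differentiableOn_dslope h0).2 Complex.differentiable_exp.differentiableOn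
  refine ⟨dslope (fun z => (dslope Complex.exp 0 z)⁻¹) 0,
    (Complex.differentiableOn_dslope h0).2 (h1.inv hne), fun z hz hzS => ?_⟩
  have h2 : Complex.exp z - 1 ≠ 0 := sub_ne_zero.2 (exp_ne_one_of_abs_im_lt hz hzS)
  rw [dslope_of_ne _ hz, slope_def_field, dslope_of_ne _ hz, slope_def_field, dslope_same,
    Complex.deriv_exp, Complex.exp_zero, sub_zero, inv_one, expPole]
  field_simp

/-- Height 3 lies below 2π, so the extended function and its derivative are bounded on this compact
convex rectangle. -/
theorem exists_lipschitz_expPole (R : ℝ) : ∃ L : ℝ, 0 ≤ L ∧ ∀ z, z ≠ 0 → |z.re| ≤ R → |z.im| ≤ 3 →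
    ‖expPole z‖ ≤ L ∧ ∀ w, w ≠ 0 → |w.re| ≤ R → |w.im| ≤ 3 →
      ‖expPole z - expPole w‖ ≤ L * ‖z - w‖ := by
  obtain ⟨f, hf, hfe⟩ := exists_differentiableOn_eq_expPole
  set S : Set ℂ := {z | |z.im| < 2 * Real.pi} with hS
  have hopen : IsOpen S := isOpen_lt (by fun_prop) continuous_const
  set K : Set ℂ := Set.Icc (-R) R ×ℂ Set.Icc (-3) 3 with hK
  have hKc : IsCompact K := isCompact_Icc.reProdIm isCompact_Icc
  have hKv : Convex ℝ K := ((convex_Icc (-R) R).linear_preimage Complex.reLm).inter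
    ((convex_Icc (-3 : ℝ) 3).linear_preimage Complex.imLm)
  have hpi : ∀ x : ℝ, |x| ≤ 3 → |x| < 2 * Real.pi := fun x hx => by linarith [Real.pi_gt_three]
  have hKS : K ⊆ S := fun z hz => hpi _ (abs_le.2 hz.2)
  obtain ⟨L₁, hL₁⟩ := hKc.exists_bound_of_continuousOn (hf.continuousOn.mono hKS)
  obtain ⟨L₂, hL₂⟩ := hKc.exists_bound_of_continuousOn
    (((hf.deriv hopen).continuousOn).mono hKS)
  refine ⟨max 0 (max L₁ L₂), le_max_left _ _, fun z hz hz1 hz2 => ?_⟩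
  have hzK : z ∈ K := ⟨abs_le.1 hz1, abs_le.1 hz2⟩
  have hze := hfe z hz (hpi _ hz2)
  refine ⟨?_, fun w hw hw1 hw2 => ?_⟩
  · rw [← hze]
    exact (hL₁ z hzK).trans ((le_max_left _ _).trans (le_max_right _ _))
  · have hwK : w ∈ K := ⟨abs_le.1 hw1, abs_le.1 hw2⟩
    rw [← hze, ← hfe w hw (hpi _ hw2)]
    exact hKv.norm_image_sub_le_of_norm_deriv_le
      (fun x hx => hf.differentiableAt (hopen.mem_nhds (hKS hx)))
      (fun x hx => (hL₂ x hx).trans ((le_max_right _ _).trans (le_max_right _ _))) hwK hzK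

/-- The logarithm of the ratio `x / (x - 1)`. -/
noncomputable def logRatio (x : ℝ) : ℝ := Real.log x - Real.log (x - 1)

theorem logRatio_pos {x : ℝ} (hx : 1 < x) : 0 < logRatio x :=
  sub_pos.2 (Real.log_lt_log (by linarith) (by linarith))

theorem logRatio_le {x : ℝ} (hx : 1 < x) : logRatio x ≤ 1 / (x - 1) := by
  rw [logRatio, ← Real.log_div (by linarith) (by linarith)]
  have h := Real.log_le_sub_one_of_pos (x := x / (x - 1)) (div_pos (by linarith) (by linarith))
  have : x / (x - 1) - 1 = 1 / (x - 1) := by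
    have : x - 1 ≠ 0 := by linarith
    field_simp; ring
  linarith

theorem abs_logRatio_sub_le {x : ℝ} (hx : 2 ≤ x) :
    |logRatio (x + 1) - logRatio x| ≤ 2 * x ^ (-2 : ℝ) := by
  have hx1 : (0 : ℝ) < x - 1 := by linarith
  have e : logRatio x - logRatio (x + 1) = Real.log (x ^ 2 / ((x - 1) * (x + 1))) := by
    rw [Real.log_div (by positivity) (by positivity), Real.log_mul (by linarith) (by linarith),
      Real.log_pow, logRatio, logRatio, add_sub_cancel_right]
    push_cast; ring
  have h1 : 1 ≤ x ^ 2 / ((x - 1) * (x + 1)) := by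
    rw [le_div_iff₀ (by positivity)]; nlinarith
  have h2 := Real.log_le_sub_one_of_pos (x := x ^ 2 / ((x - 1) * (x + 1))) (by positivity)
  have h3 : x ^ 2 / ((x - 1) * (x + 1)) - 1 ≤ 2 * x ^ (-2 : ℝ) := by
    rw [Real.rpow_neg (by linarith), Real.rpow_two, sub_le_iff_le_add,
      div_le_iff₀ (by positivity)]
    have hx2 : x ^ 2 ≠ 0 := by positivity
    have : (2 * (x ^ 2)⁻¹ + 1) * ((x - 1) * (x + 1)) = 2 - 2 * (x ^ 2)⁻¹ + x ^ 2 - 1 := by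
      field_simp; ring
    rw [this]
    have h4 : (x ^ 2)⁻¹ ≤ 1 / 4 := by
      rw [inv_le_comm₀ (by positivity) (by norm_num)]
      nlinarith
    linarith
  rw [abs_sub_comm, e, abs_of_nonneg (Real.log_nonneg h1)]
  linarith

theorem exp_logRatio {x : ℝ} (hx : 1 < x) : Real.exp (logRatio x) = x / (x - 1) := by
  rw [logRatio, Real.exp_sub, Real.exp_log (by linarith), Real.exp_log (by linarith)]

/-- The coefficient of the telescoping primitive of `mtCellErr 0 s 0`. -/
noncomputable def zetaCoeff (s : ℂ) (x : ℝ) : ℂ :=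
  (expPole (logRatio x) - s * expPole (s * logRatio x)) / (1 - s)

theorem cpow_sub_one_eq {x : ℝ} (hx : 1 < x) (s : ℂ) :
    ((x - 1 : ℝ) : ℂ) ^ (-s) = (x : ℂ) ^ (-s) * Complex.exp (s * logRatio x) := by
  have h1 : (x : ℂ) ≠ 0 := by exact_mod_cast (by linarith : x ≠ 0)
  have h2 : ((x - 1 : ℝ) : ℂ) ≠ 0 := by exact_mod_cast (by linarith : x - 1 ≠ 0)
  rw [Complex.cpow_def_of_ne_zero h1, Complex.cpow_def_of_ne_zero h2, ← Complex.exp_add,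
    ← Complex.ofReal_log (by linarith), ← Complex.ofReal_log (by linarith), logRatio]
  congr 1
  push_cast
  ring

/-- The two subtracted poles both equal 1 / `logRatio x` and cancel. This form serves algebra, the
`expPole` form serves estimates. -/
theorem zetaCoeff_eq {s : ℂ} {x : ℝ} (hx : 1 < x) (hs : s ≠ 0) :
    zetaCoeff s x = (((x - 1 : ℝ) : ℂ) - s / (Complex.exp (s * logRatio x) - 1)) / (1 - s) := by
  have hl : (logRatio x : ℂ) ≠ 0 := by exact_mod_cast (logRatio_pos hx).ne'
  have h1 : Complex.exp (logRatio x) - 1 = 1 / ((x - 1 : ℝ) : ℂ) := by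
    rw [← Complex.ofReal_exp, exp_logRatio hx]
    have : x - 1 ≠ 0 := by linarith
    have : x / (x - 1) - 1 = 1 / (x - 1) := by field_simp; ring
    exact_mod_cast this
  have h2 : s * (1 / (s * logRatio x)) = 1 / (logRatio x : ℂ) := by field_simp
  rw [zetaCoeff, expPole, expPole, h1, one_div_one_div, mul_sub, h2]
  ring

/-- The coefficient c is chosen so that the cell error is exactly (x^(-s) - (x+1)^(-s)) c(x+1).
Adding and subtracting x^(-s) c(x) leaves a telescoping difference and a term containing only the
variation of c. -/
theorem mtCellErr_eq_telescoping {s : ℂ} {x : ℝ} (hx : 1 < x) (hs : 0 < s.re) (hs1 : s ≠ 1)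
    (hq : Complex.exp (s * logRatio (x + 1)) ≠ 1) :
    mtCellErr 0 s 0 x = (x : ℂ) ^ (-s) * zetaCoeff s x -
      ((x + 1 : ℝ) : ℂ) ^ (-s) * zetaCoeff s (x + 1) +
      (x : ℂ) ^ (-s) * (zetaCoeff s (x + 1) - zetaCoeff s x) := by
  have hs0 : s ≠ 0 := fun h => by rw [h] at hs; simp at hs
  have hI := mtTailInt_sub (m := 0) (N := x) (M := x + 1) le_rfl (by linarith) (by linarith)
    (by linarith) (a := s) (b := 0) (by simpa) (by simpa)
  have hT : ∀ N : ℝ, 0 < N → mtTailInt 0 s 0 N = (N : ℂ) ^ (-s) * N / (s - 1) := fun N hN => by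
    simp [mtTailInt, mtKernel]
  have hc := cpow_sub_one_eq (x := x + 1) (by linarith) s
  rw [add_sub_cancel_right] at hc
  have hs2 : s - 1 ≠ 0 := sub_ne_zero.2 hs1
  have hs3 : 1 - s ≠ 0 := sub_ne_zero.2 hs1.symm
  have hq' : Complex.exp (s * logRatio (x + 1)) - 1 ≠ 0 := sub_ne_zero.2 hq
  rw [mtCellErr, ← hI, hT _ (by linarith), hT _ (by linarith), mtKernel_zero_left,
    zetaCoeff_eq (x := x + 1) (by linarith) hs0, add_sub_cancel_right]
  generalize Complex.exp (s * logRatio (x + 1)) = q at *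
  generalize zetaCoeff s x = z
  rw [hc]
  generalize ((x + 1 : ℝ) : ℂ) ^ (-s) = p
  push_cast
  have hs4 : s - 1 = -(1 - s) := by ring
  rw [hs4]
  field_simp
  ring

theorem exists_norm_tsum_zeta_cellErr_le {σ : ℝ} (hσ : 0 < σ) : ∃ C : ℝ, 0 ≤ C ∧
    ∀ (s : ℂ) (y : ℕ), s.re = σ → 2 ≤ s.im → s.im ≤ y →
      ‖∑' k : ℕ, mtCellErr 0 s 0 (y + k)‖ ≤ C * (y : ℝ) ^ (-σ) := by
  obtain ⟨L, hL0, hL⟩ := exists_lipschitz_expPole (σ + 1)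
  refine ⟨L * (2 + σ) + 2 * L * (1 + (1 + σ) ^ 2) * (2 ^ (σ + 1) / σ), by positivity,
    fun s y hre him hy => ?_⟩
  set t := s.im with ht
  have hy2 : (2 : ℝ) ≤ y := him.trans hy
  have hy2' : 2 ≤ y := by exact_mod_cast hy2
  have hs1 : s ≠ 1 := fun h => by rw [h] at ht; simp at ht; linarith
  have hns : ‖s‖ ≤ σ + t := by
    have := Complex.norm_le_abs_re_add_abs_im s
    rwa [hre, abs_of_pos hσ, ← ht, abs_of_pos (by linarith)] at this
  have hns1 : t ≤ ‖1 - s‖ := by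
    have := Complex.abs_im_le_norm (1 - s)
    simp only [Complex.sub_im, Complex.one_im, zero_sub, abs_neg] at this
    exact (le_abs_self _).trans this
  -- Here t ≤ x is decisive: t · `logRatio x` ≤ x/(x-1) ≤ 2, so s · `logRatio x` stays in the
  -- rectangle of height 3.
  have hl : ∀ x : ℝ, (y : ℝ) ≤ x → 0 < logRatio x ∧ logRatio x ≤ 1 ∧ t * logRatio x ≤ 2 := by
    intro x hx
    have h1 : 1 < x := by linarith
    have h2 := logRatio_le h1
    have h3 : 1 / (x - 1) ≤ 1 := by rw [div_le_one (by linarith)]; linarith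
    refine ⟨logRatio_pos h1, h2.trans h3, ?_⟩
    calc t * logRatio x ≤ x * (1 / (x - 1)) := by
          have := (logRatio_pos h1).le
          gcongr
          linarith
      _ ≤ 2 := by rw [mul_one_div, div_le_iff₀ (by linarith)]; linarith
  have hrect : ∀ x : ℝ, (y : ℝ) ≤ x → ((logRatio x : ℂ) ≠ 0 ∧ |(logRatio x : ℂ).re| ≤ σ + 1 ∧
      |(logRatio x : ℂ).im| ≤ 3) ∧ (s * logRatio x ≠ 0 ∧ |(s * logRatio x).re| ≤ σ + 1 ∧
      |(s * logRatio x).im| ≤ 3) := by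
    intro x hx
    obtain ⟨h1, h2, h3⟩ := hl x hx
    have hs0 : s ≠ 0 := fun h => by rw [h] at ht; simp at ht; linarith
    have hl0 : (logRatio x : ℂ) ≠ 0 := by exact_mod_cast h1.ne'
    refine ⟨⟨hl0, ?_, by simp⟩, mul_ne_zero hs0 hl0, ?_, ?_⟩
    · rw [Complex.ofReal_re, abs_of_pos h1]; linarith
    · rw [Complex.re_mul_ofReal, hre, abs_of_pos (by positivity)]
      nlinarith
    · rw [Complex.im_mul_ofReal, ← ht, abs_of_pos (by positivity)]
      linarith
  have ht0 : 0 < t := by linarith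
  have hcoeff : ∀ x : ℝ, (y : ℝ) ≤ x → ‖zetaCoeff s x‖ ≤ L * (2 + σ) := by
    intro x hx
    obtain ⟨⟨a1, a2, a3⟩, b1, b2, b3⟩ := hrect x hx
    rw [zetaCoeff, norm_div, div_le_iff₀ (by linarith)]
    calc _ ≤ L + (σ + t) * L := by
          refine (norm_sub_le _ _).trans ?_
          rw [norm_mul]
          have h1 := (hL _ a1 a2 a3).1
          have h2 := (hL _ b1 b2 b3).1
          gcongr
      _ ≤ L * (2 + σ) * t := by nlinarith [mul_nonneg hL0 hσ.le]
      _ ≤ _ := by gcongr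
  -- The prefactor s and the argument s · `logRatio` give two factors of order t; the denominator 1
  -- - s removes one, and t ≤ x lowers x^(-2) to x^(-1) for the other.
  have hdiff : ∀ x : ℝ, (y : ℝ) ≤ x → ‖zetaCoeff s (x + 1) - zetaCoeff s x‖ ≤
      2 * L * (1 + (1 + σ) ^ 2) * x ^ (-1 : ℝ) := by
    intro x hx
    obtain ⟨⟨a1, a2, a3⟩, b1, b2, b3⟩ := hrect x hx
    obtain ⟨⟨c1, c2, c3⟩, d1, d2, d3⟩ := hrect (x + 1) (by linarith)
    have h1 := (hL _ c1 c2 c3).2 _ a1 a2 a3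
    have h2 := (hL _ d1 d2 d3).2 _ b1 b2 b3
    have h3 := abs_logRatio_sub_le (x := x) (by linarith)
    rw [← mul_sub, norm_mul] at h2
    rw [← Complex.ofReal_sub, Complex.norm_real, Real.norm_eq_abs] at h1 h2
    have hx0 : 0 < x := by linarith
    have e : zetaCoeff s (x + 1) - zetaCoeff s x = ((expPole (logRatio (x + 1)) -
        expPole (logRatio x)) - s * (expPole (s * logRatio (x + 1)) - expPole (s * logRatio x))) /
        (1 - s) := by
      rw [zetaCoeff, zetaCoeff]; ring
    rw [e, norm_div, div_le_iff₀ (by linarith)]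
    have h4 : 1 + (σ + t) * (σ + t) ≤ (1 + (1 + σ) ^ 2) * t ^ 2 := by
      have g1 : σ + t ≤ (1 + σ) * t := by nlinarith
      have g2 : (σ + t) * (σ + t) ≤ ((1 + σ) * t) * ((1 + σ) * t) := by gcongr
      nlinarith
    have h5 : x ^ (-2 : ℝ) = x ^ (-1 : ℝ) * x⁻¹ := by
      rw [← Real.rpow_neg_one x, ← Real.rpow_add hx0]; norm_num
    have h6 : t * x⁻¹ ≤ 1 := by rw [← div_eq_mul_inv, div_le_one hx0]; linarith
    calc _ ≤ L * |logRatio (x + 1) - logRatio x| +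
          (σ + t) * (L * ((σ + t) * |logRatio (x + 1) - logRatio x|)) := by
          refine (norm_sub_le _ _).trans ?_
          rw [norm_mul]
          have h2' := h2.trans (mul_le_mul_of_nonneg_left (mul_le_mul_of_nonneg_right hns
            (abs_nonneg (logRatio (x + 1) - logRatio x))) hL0)
          gcongr
      _ = L * (1 + (σ + t) * (σ + t)) * |logRatio (x + 1) - logRatio x| := by ring
      _ ≤ L * ((1 + (1 + σ) ^ 2) * t ^ 2) * (2 * (x ^ (-1 : ℝ) * x⁻¹)) := by
          rw [← h5]; gcongr
      _ = 2 * L * (1 + (1 + σ) ^ 2) * x ^ (-1 : ℝ) * t * (t * x⁻¹) := by ring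
      _ ≤ 2 * L * (1 + (1 + σ) ^ 2) * x ^ (-1 : ℝ) * t * 1 := by gcongr
      _ ≤ _ := by rw [mul_one]; gcongr
  have hnorm : ∀ k : ℕ, ‖(((y : ℝ) + k : ℝ) : ℂ) ^ (-s)‖ = ((y : ℝ) + k) ^ (-σ) := fun k => by
    rw [Complex.norm_cpow_eq_rpow_re_of_pos (by positivity), Complex.neg_re, hre]
  have hyk : ∀ k : ℕ, (y : ℝ) ≤ y + k := fun k => by linarith [(Nat.cast_nonneg k : (0 : ℝ) ≤ k)]
  set v : ℕ → ℂ := fun k => (((y : ℝ) + k : ℝ) : ℂ) ^ (-s) * zetaCoeff s (y + k) with hv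
  set w : ℕ → ℂ := fun k => (((y : ℝ) + k : ℝ) : ℂ) ^ (-s) *
    (zetaCoeff s (y + k + 1) - zetaCoeff s (y + k)) with hw
  have hwb : ∀ k : ℕ, ‖w k‖ ≤ 2 * L * (1 + (1 + σ) ^ 2) * ((y : ℝ) + k) ^ (-σ - 1) := by
    intro k
    have h0 : (0 : ℝ) < y + k := by linarith [hyk k]
    rw [hw, norm_mul, hnorm, sub_eq_add_neg (-σ), Real.rpow_add h0]
    calc _ ≤ ((y : ℝ) + k) ^ (-σ) * (2 * L * (1 + (1 + σ) ^ 2) * ((y : ℝ) + k) ^ (-1 : ℝ)) :=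
          mul_le_mul_of_nonneg_left (hdiff _ (hyk k)) (by positivity)
      _ = _ := by ring
  have hv0 : Tendsto v atTop (𝓝 0) := by
    refine squeeze_zero_norm (a := fun k : ℕ => ((y : ℝ) + k) ^ (-σ) * (L * (2 + σ))) (fun k => ?_)
      (by simpa using (tendsto_natCast_add_rpow_neg hσ y).mul_const (L * (2 + σ)))
    rw [hv, norm_mul, hnorm]
    exact mul_le_mul_of_nonneg_left (hcoeff _ (hyk k)) (by positivity)
  have htel : ∀ k : ℕ, mtCellErr 0 s 0 (y + k) = v k - v (k + 1) + w k := by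
    intro k
    have hq : Complex.exp (s * logRatio ((y : ℝ) + k + 1)) ≠ 1 := by
      obtain ⟨-, b1, b2, b3⟩ := hrect ((y : ℝ) + k + 1) (by linarith [hyk k])
      exact exp_ne_one_of_abs_im_lt b1 (by linarith [Real.pi_gt_three])
    have := mtCellErr_eq_telescoping (x := (y : ℝ) + k) (by linarith [hyk k]) (by linarith) hs1 hq
    rw [this, hv, hw]
    push_cast
    rw [← add_assoc, ← add_assoc]
  rw [tsum_eq_add_tsum_of_telescoping (summable_mtCellErr le_rfl (by positivity) (by omega)
    (by simp [hre, hσ])) (summable_of_norm_le_rpow_tail hσ (by omega) hwb) hv0 htel]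
  refine (norm_add_le _ _).trans ?_
  rw [add_mul]
  refine add_le_add ?_ (norm_tsum_le_rpow_tail hσ (by omega) hwb)
  rw [hv]
  have h0 := hnorm 0
  have h1 := hcoeff _ (hyk 0)
  simp only [Nat.cast_zero, add_zero] at h0 h1 ⊢
  rw [norm_mul, h0, mul_comm]
  gcongr

/-! ### Uniform bounds for the tails -/

theorem norm_cpow_neg_sub_le {a : ℂ} (ha : 0 ≤ a.re) {x u v : ℝ} (hx : 0 < x) (hu : x ≤ u)
    (hv : x ≤ v) :
    ‖(u : ℂ) ^ (-a) - (v : ℂ) ^ (-a)‖ ≤ ‖a‖ * x ^ (-a.re - 1) * |u - v| := by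
  have h := (convex_Ici x).norm_image_sub_le_of_norm_hasDerivWithin_le
    (f := fun v : ℝ => (v : ℂ) ^ (-a)) (C := ‖a‖ * x ^ (-a.re - 1))
    (fun w hw => (hasDerivAt_ofReal_cpow_neg (hx.trans_le hw) a).hasDerivWithinAt)
    (fun w hw => ?_) (show v ∈ Set.Ici x from hv) (show u ∈ Set.Ici x from hu)
  · simpa [Real.norm_eq_abs] using h
  · have hw0 : 0 < w := hx.trans_le hw
    rw [norm_mul, norm_div, norm_neg, Complex.norm_real, Real.norm_of_nonneg hw0.le,
      Complex.norm_cpow_eq_rpow_re_of_pos hw0, Complex.neg_re]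
    calc _ = ‖a‖ * w ^ (-a.re - 1) := by rw [Real.rpow_sub hw0, Real.rpow_one]; ring
      _ ≤ _ := mul_le_mul_of_nonneg_left
        (Real.rpow_le_rpow_of_nonpos hx hw (by linarith)) (norm_nonneg _)

/-- Freezing v^(-a) at the right endpoint isolates a pure zeta cell error at m + n; the correction
varies only the factor with fixed exponent a, so it is bounded independently of the imaginary part
of b. -/
theorem mtCellErr_eq_add {m n : ℝ} (hm : 0 ≤ m) (hn : 0 < n) (a b : ℂ) :
    mtCellErr m a b n = ((n + 1 : ℝ) : ℂ) ^ (-a) * mtCellErr 0 b 0 (m + n) +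
      ∫ v in n..(n + 1), (((n + 1 : ℝ) : ℂ) ^ (-a) - (v : ℂ) ^ (-a)) *
        ((m + v : ℝ) : ℂ) ^ (-b) := by
  have hshift : ∫ v in (m + n)..(m + n + 1), mtKernel 0 b 0 v
      = ∫ v in n..(n + 1), ((m + v : ℝ) : ℂ) ^ (-b) := by
    rw [add_assoc, ← intervalIntegral.integral_comp_add_left]
    simp only [mtKernel_zero_left]
  have hc : IntervalIntegrable (fun v : ℝ => ((m + v : ℝ) : ℂ) ^ (-b)) MeasureTheory.volume
      n (n + 1) := by
    have := intervalIntegrable_mtKernel hm hn (by linarith : n ≤ n + 1) 0 b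
    have e : mtKernel m 0 b = fun v : ℝ => ((m + v : ℝ) : ℂ) ^ (-b) := by
      funext v; simp [mtKernel]
    rwa [e] at this
  have hk : IntervalIntegrable (fun v : ℝ => (v : ℂ) ^ (-a) * ((m + v : ℝ) : ℂ) ^ (-b))
      MeasureTheory.volume n (n + 1) :=
    intervalIntegrable_mtKernel hm hn (by linarith : n ≤ n + 1) a b
  simp_rw [sub_mul]
  rw [intervalIntegral.integral_sub (hc.const_mul _) hk,
    intervalIntegral.integral_const_mul, ← hshift, mtCellErr, mtCellErr, mtKernel_zero_left,
    mtKernel, ← add_assoc m]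
  simp only [mtKernel]
  ring

theorem norm_integral_cpow_sub_mul_le {m n : ℝ} (hm : 0 ≤ m) (hn : 0 < n) {a b : ℂ}
    (ha : 0 ≤ a.re) (hb : 0 ≤ b.re) :
    ‖∫ v in n..(n + 1), (((n + 1 : ℝ) : ℂ) ^ (-a) - (v : ℂ) ^ (-a)) *
        ((m + v : ℝ) : ℂ) ^ (-b)‖ ≤ ‖a‖ * n ^ (-(a.re + b.re) - 1) := by
  refine (intervalIntegral.norm_integral_le_of_norm_le_const
    (C := ‖a‖ * n ^ (-(a.re + b.re) - 1)) fun v hv => ?_).trans (by simp)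
  rw [Set.uIoc_of_le (by linarith)] at hv
  rw [norm_mul, Complex.norm_cpow_eq_rpow_re_of_pos (by linarith [hv.1]), Complex.neg_re]
  have h1 := norm_cpow_neg_sub_le ha hn (by linarith : n ≤ n + 1) hv.1.le
  have h2 : (m + v) ^ (-b.re) ≤ n ^ (-b.re) :=
    Real.rpow_le_rpow_of_nonpos hn (by linarith [hv.1]) (by linarith)
  have h3 : |n + 1 - v| ≤ 1 := by rw [abs_le]; constructor <;> linarith [hv.1, hv.2]
  calc _ ≤ (‖a‖ * n ^ (-a.re - 1) * 1) * n ^ (-b.re) := by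
        refine mul_le_mul (h1.trans (mul_le_mul_of_nonneg_left h3 (by positivity))) h2
          (Real.rpow_nonneg (by linarith [hv.1]) _) (by positivity)
    _ = _ := by
        rw [mul_one, mul_assoc, ← Real.rpow_add hn]; congr 2; ring

/-- Summation by parts: the zeta cell errors are differences of their tail sums D, which are bounded
without loss in b, and differencing the weight (N+k+1)^(-a) costs only ‖a‖. -/
theorem exists_norm_tsum_mtCellErr_le {a : ℂ} (ha : 0 ≤ a.re) {σ : ℝ} (hσ : 0 < σ) :
    ∃ C : ℝ, 0 ≤ C ∧ ∀ (b : ℂ) (m N : ℕ), b.re = σ → 2 ≤ b.im → 1 ≤ N → m ≤ N →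
      b.im ≤ (m + N : ℕ) →
      ‖∑' k : ℕ, mtCellErr m a b (N + k)‖ ≤ C * (N : ℝ) ^ (-(a.re + σ)) := by
  obtain ⟨C, hC0, hC⟩ := exists_norm_tsum_zeta_cellErr_le hσ
  refine ⟨C + ‖a‖ * (C + 1) * (2 ^ (a.re + σ + 1) / (a.re + σ)), by positivity,
    fun b m N hb hb2 hN hmN him => ?_⟩
  have hN' : (1 : ℝ) ≤ N := by exact_mod_cast hN
  have hασ : 0 < a.re + σ := by linarith
  set D : ℕ → ℂ := fun k => ∑' j : ℕ, mtCellErr 0 b 0 ((m + N + k : ℕ) + j) with hD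
  have hDs : ∀ k : ℕ, mtCellErr 0 b 0 ((m : ℝ) + (N + k)) = D k - D (k + 1) := by
    intro k
    simp only [hD]
    rw [(summable_mtCellErr (m := 0) (N := m + N + k) le_rfl (by positivity) (by omega)
      (by simp [hb, hσ])).tsum_eq_zero_add]
    have e : ∀ j : ℕ, ((m + N + (k + 1) : ℕ) : ℝ) + j = ((m + N + k : ℕ) : ℝ) + ((j + 1 : ℕ) : ℝ) :=
      fun j => by push_cast; ring
    simp_rw [e]
    push_cast
    rw [add_zero, add_sub_cancel_right, add_assoc]
  have hNk : ∀ k : ℕ, (0 : ℝ) < N + k := fun k => by positivity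
  have hDb : ∀ k, ‖D k‖ ≤ C * ((N : ℝ) + k) ^ (-σ) := by
    intro k
    refine (hC b (m + N + k) hb hb2 (him.trans (by exact_mod_cast (by omega)))).trans ?_
    refine mul_le_mul_of_nonneg_left (Real.rpow_le_rpow_of_nonpos (hNk k) ?_ (by linarith)) hC0
    push_cast
    linarith [(Nat.cast_nonneg m : (0 : ℝ) ≤ m)]
  have hnorm : ∀ k : ℕ, ‖(((N : ℝ) + k + 1 : ℝ) : ℂ) ^ (-a)‖ ≤ ((N : ℝ) + k) ^ (-a.re) := by
    intro k
    rw [Complex.norm_cpow_eq_rpow_re_of_pos (by positivity), Complex.neg_re]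
    exact Real.rpow_le_rpow_of_nonpos (hNk k) (by linarith) (by linarith)
  set v : ℕ → ℂ := fun k => (((N : ℝ) + k + 1 : ℝ) : ℂ) ^ (-a) * D k with hv
  set R : ℕ → ℂ := fun k => ∫ v in ((N : ℝ) + k)..((N : ℝ) + k + 1),
    ((((N : ℝ) + k + 1 : ℝ) : ℂ) ^ (-a) - (v : ℂ) ^ (-a)) * ((m + v : ℝ) : ℂ) ^ (-b) with hR
  set w : ℕ → ℂ := fun k => ((((N : ℝ) + k + 1 + 1 : ℝ) : ℂ) ^ (-a) -
    (((N : ℝ) + k + 1 : ℝ) : ℂ) ^ (-a)) * D (k + 1) + R k with hw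
  have hvb : ∀ k, ‖v k‖ ≤ C * ((N : ℝ) + k) ^ (-(a.re + σ)) := by
    intro k
    rw [hv, norm_mul, neg_add, Real.rpow_add (hNk k)]
    calc _ ≤ ((N : ℝ) + k) ^ (-a.re) * (C * ((N : ℝ) + k) ^ (-σ)) :=
          mul_le_mul (hnorm k) (hDb k) (norm_nonneg _) (by positivity)
      _ = _ := by ring
  have hwb : ∀ k, ‖w k‖ ≤ ‖a‖ * (C + 1) * ((N : ℝ) + k) ^ (-(a.re + σ) - 1) := by
    intro k
    have h1 := norm_cpow_neg_sub_le ha (hNk k) (u := N + k + 1 + 1) (v := N + k + 1)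
      (by linarith) (by linarith)
    rw [add_sub_cancel_left, abs_one, mul_one] at h1
    have h2 : ‖D (k + 1)‖ ≤ C * ((N : ℝ) + k) ^ (-σ) := by
      refine (hDb (k + 1)).trans (mul_le_mul_of_nonneg_left
        (Real.rpow_le_rpow_of_nonpos (hNk k) ?_ (by linarith)) hC0)
      push_cast; linarith
    have h3 := norm_integral_cpow_sub_mul_le (m := m) (by positivity) (hNk k) ha
      (by rw [hb]; exact hσ.le : 0 ≤ b.re)
    rw [hb] at h3
    refine (norm_add_le _ _).trans ?_
    rw [norm_mul]
    have e : ((N : ℝ) + k) ^ (-(a.re + σ) - 1)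
        = ((N : ℝ) + k) ^ (-a.re - 1) * ((N : ℝ) + k) ^ (-σ) := by
      rw [← Real.rpow_add (hNk k)]; congr 1; ring
    calc _ ≤ (‖a‖ * ((N : ℝ) + k) ^ (-a.re - 1)) * (C * ((N : ℝ) + k) ^ (-σ)) +
          ‖a‖ * ((N : ℝ) + k) ^ (-(a.re + σ) - 1) :=
          add_le_add (mul_le_mul h1 h2 (norm_nonneg _) (by positivity)) h3
      _ = _ := by rw [e]; ring
  have hv0 : Tendsto v atTop (𝓝 0) := squeeze_zero_norm hvb
    (by simpa using (tendsto_natCast_add_rpow_neg hασ N).const_mul C)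
  have htel : ∀ k : ℕ, mtCellErr m a b (N + k) = v k - v (k + 1) + w k := by
    intro k
    rw [mtCellErr_eq_add (by positivity) (hNk k), hDs k]
    have e : (N : ℝ) + ((k + 1 : ℕ) : ℝ) + 1 = N + k + 1 + 1 := by push_cast; ring
    simp only [hv, hw, hR, e]
    ring
  have hmN' : (m : ℝ) ≤ N := by exact_mod_cast hmN
  rw [tsum_eq_add_tsum_of_telescoping (summable_mtCellErr (by positivity) hmN' hN
    (by rw [hb]; exact hασ)) (summable_of_norm_le_rpow_tail hασ hN hwb) hv0 htel, add_mul]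
  refine (norm_add_le _ _).trans (add_le_add ?_ (norm_tsum_le_rpow_tail hασ hN hwb))
  simpa using hvb 0

/-- The integral part carries N / ‖a + b - 1‖, which is bounded since N ≤ B · Im b and Im a ≥ 0.
Because m ≥ 1, the bound Im b ≤ N + 1 left by rounding down still gives Im b ≤ m + N. -/
theorem exists_norm_mtTail_le {a : ℂ} (ha : 0 ≤ a.re) (ha' : 0 ≤ a.im) {σ : ℝ} (hσ : 0 < σ)
    {B : ℝ} : ∃ C : ℝ, 0 ≤ C ∧ ∀ (b : ℂ) (m N : ℕ), b.re = σ → 2 ≤ b.im →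
      1 ≤ m → m ≤ N → b.im ≤ N + 1 → N ≤ B * b.im →
      ‖mtTail m a b N‖ ≤ C * (N : ℝ) ^ (-(a.re + σ)) := by
  obtain ⟨C, hC0, hC⟩ := exists_norm_tsum_mtCellErr_le ha hσ
  refine ⟨2 ^ |σ| * (2 + ‖a‖ / (a.re + σ)) * |B| + C, by positivity,
    fun b m N hb hb2 hm hmN hbN hNB => ?_⟩
  have hm' : (1 : ℝ) ≤ m := by exact_mod_cast hm
  have hmN' : (m : ℝ) ≤ N := by exact_mod_cast hmN
  have hN0 : (0 : ℝ) < N := by linarith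
  rw [add_mul]
  refine (norm_add_le _ _).trans (add_le_add ?_ (hC b m N hb hb2 (hm.trans hmN) hmN
    (by push_cast; linarith)))
  refine (norm_mtTailInt_le (by linarith) hmN' hN0 (by rw [hb]; linarith)).trans ?_
  rw [hb]
  have him : b.im ≤ ‖a + b - 1‖ := by
    have := (le_abs_self _).trans (Complex.abs_im_le_norm (a + b - 1))
    simp only [Complex.add_im, Complex.sub_im, Complex.one_im] at this
    linarith
  rw [div_le_iff₀ (by linarith), sub_eq_add_neg 1, Real.rpow_add hN0, Real.rpow_one]
  have h1 : (N : ℝ) ≤ |B| * ‖a + b - 1‖ :=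
    hNB.trans (mul_le_mul (le_abs_self B) him (by linarith) (abs_nonneg B))
  calc _ ≤ 2 ^ |σ| * (2 + ‖a‖ / (a.re + σ)) * (|B| * ‖a + b - 1‖ * (N : ℝ) ^ (-(a.re + σ))) := by
        gcongr
    _ = _ := by ring

/-- The trivial cell-error bound is enough here: its factor ‖z‖ ≤ A N is absorbed into the exponent
1 - Re z. -/
theorem norm_mtTail_zero_le {z : ℂ} {A : ℝ} {N : ℕ} (hz : 0 < z.re) (hz1 : 1 ≤ ‖z - 1‖)
    (hN : 1 ≤ N) (hzA : ‖z‖ ≤ A * N) :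
    ‖mtTail 0 z 0 N‖ ≤ (2 + 2 / z.re + A * (2 ^ (z.re + 1) / z.re)) * (N : ℝ) ^ (1 - z.re) := by
  have hN0 : (0 : ℝ) < N := by exact_mod_cast hN
  have h1 := norm_mtTailInt_le (m := 0) (N := N) (a := z) (b := 0) le_rfl hN0.le hN0
    (by simpa using hz)
  have h2 := norm_tsum_mtCellErr_le (m := 0) (N := N) (a := z) (b := 0) le_rfl hN0.le hN
    (by simpa using hz)
  simp only [Complex.zero_re, abs_zero, Real.rpow_zero, one_mul, add_zero, norm_zero,
    mul_one] at h1 h2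
  have h3 : ‖z‖ ≤ 2 * ‖z - 1‖ := by
    have := norm_add_le (z - 1) 1
    rw [sub_add_cancel, norm_one] at this
    linarith
  have h4 : (2 + ‖z‖ / z.re) / ‖z - 1‖ ≤ 2 + 2 / z.re := by
    rw [div_le_iff₀ (by linarith)]
    calc 2 + ‖z‖ / z.re ≤ 2 * ‖z - 1‖ + 2 * ‖z - 1‖ / z.re := by gcongr; linarith
      _ = _ := by ring
  rw [add_mul]
  refine (norm_add_le _ _).trans (add_le_add (h1.trans ?_) (h2.trans ?_))
  · rw [mul_div_right_comm]
    gcongr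
  · rw [sub_eq_add_neg, Real.rpow_add hN0, Real.rpow_one]
    calc _ ≤ A * N * (2 ^ (z.re + 1) / z.re) * (N : ℝ) ^ (-z.re) := by gcongr
      _ = _ := by ring

/-! ### Truncation errors of the cone and the diagonal -/

/-- The comparison series with exponent 3/2 is wasteful but treats every σ at once, without a
logarithm at σ = 1, and is just what the claimed error allows. -/
theorem exists_sum_rpow_neg_le (σ : ℝ) : ∃ C : ℝ, 0 ≤ C ∧ ∀ N : ℕ, 1 ≤ N →
    ∑ i ∈ Finset.range N, ((i : ℝ) + 1) ^ (-σ) ≤ C * (N : ℝ) ^ (max σ (3 / 2) - σ) := by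
  have hs : Summable fun i : ℕ => ((i : ℝ) + 1) ^ (-(3 / 2 : ℝ)) := by
    refine (summable_rpow_tail (α := 1 / 2) (by norm_num) (N := 1) le_rfl).congr fun k => ?_
    rw [Nat.cast_one, add_comm]; norm_num
  refine ⟨∑' i : ℕ, ((i : ℝ) + 1) ^ (-(3 / 2 : ℝ)), tsum_nonneg fun i => by positivity,
    fun N hN => ?_⟩
  have h : ∀ i ∈ Finset.range N, ((i : ℝ) + 1) ^ (-σ) ≤
      ((i : ℝ) + 1) ^ (-(3 / 2 : ℝ)) * (N : ℝ) ^ (max σ (3 / 2) - σ) := by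
    intro i hi
    have hiN : (i : ℝ) + 1 ≤ N := by exact_mod_cast Finset.mem_range.1 hi
    have hi1 : (1 : ℝ) ≤ (i : ℝ) + 1 := by linarith [(Nat.cast_nonneg i : (0 : ℝ) ≤ i)]
    calc ((i : ℝ) + 1) ^ (-σ) ≤ ((i : ℝ) + 1) ^ (-(3 / 2 : ℝ) + (max σ (3 / 2) - σ)) :=
          Real.rpow_le_rpow_of_exponent_le hi1 (by linarith [le_max_right σ (3 / 2)])
      _ = ((i : ℝ) + 1) ^ (-(3 / 2 : ℝ)) * ((i : ℝ) + 1) ^ (max σ (3 / 2) - σ) :=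
          Real.rpow_add (by linarith) _ _
      _ ≤ _ := mul_le_mul_of_nonneg_left (Real.rpow_le_rpow (by linarith) hiN
          (by linarith [le_max_left σ (3 / 2)])) (by positivity)
  calc _ ≤ _ := Finset.sum_le_sum h
    _ ≤ _ := by
      rw [← Finset.sum_mul]
      exact mul_le_mul_of_nonneg_right (hs.sum_le_tsum _ fun i _ => by positivity) (by positivity)

theorem zetaRight_eq_sum_add {z : ℂ} (hz : 0 < z.re) (hz1 : z ≠ 1) {N : ℕ} (hN : 1 ≤ N) :
    zetaRight z = ∑ i ∈ Finset.range N, (((i + 1 : ℕ) : ℝ) : ℂ) ^ (-z) + mtTail 0 z 0 N := by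
  obtain ⟨K, rfl⟩ := Nat.exists_eq_add_of_le' hN
  have h := sum_range_add_mtTail (m := 0) (N := 1) (a := z) (b := 0) le_rfl (by simp) le_rfl
    (by simpa using hz) (by simpa using hz1) K
  rw [zetaRight, ← h, Finset.sum_range_succ', add_comm 1 K]
  simp only [mtKernel_zero_left]
  have e : ∀ k : ℕ, ((1 : ℕ) : ℝ) + k + 1 = ((k + 1 + 1 : ℕ) : ℝ) := fun k => by push_cast; ring
  simp_rw [e]
  simp
  ring

/-- The partial sum over `m < n ≤ N`. -/
noncomputable def mtConeSum (s : ℂ × ℂ × ℂ) (N : ℕ) : ℂ :=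
  ∑ i ∈ Finset.range N, ∑ k ∈ Finset.range (N - (i + 1)), mtTerm s (i + 1) (i + 1 + k + 1)

theorem sum_square_eq (f : ℕ → ℕ → ℂ) (N : ℕ) :
    ∑ m ∈ Finset.Icc 1 N, ∑ n ∈ Finset.Icc 1 N, f m n =
      ∑ i ∈ Finset.range N, ∑ k ∈ Finset.range (N - (i + 1)), f (i + 1) (i + 1 + k + 1) +
      ∑ i ∈ Finset.range N, ∑ k ∈ Finset.range (N - (i + 1)), f (i + 1 + k + 1) (i + 1) +
      ∑ i ∈ Finset.range N, f (i + 1) (i + 1) := by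
  have htri : ∀ (g : ℕ → ℕ → ℂ) (N : ℕ),
      ∑ i ∈ Finset.range (N + 1), ∑ k ∈ Finset.range (N + 1 - (i + 1)), g (i + 1) (i + 1 + k + 1) =
      ∑ i ∈ Finset.range N, ∑ k ∈ Finset.range (N - (i + 1)), g (i + 1) (i + 1 + k + 1) +
      ∑ i ∈ Finset.range N, g (i + 1) (N + 1) := by
    intro g N
    rw [Finset.sum_range_succ, Nat.sub_self, Finset.sum_range_zero, add_zero,
      ← Finset.sum_add_distrib]
    refine Finset.sum_congr rfl fun i hi => ?_
    have hiN := Finset.mem_range.1 hi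
    rw [show N + 1 - (i + 1) = N - (i + 1) + 1 by omega, Finset.sum_range_succ,
      show i + 1 + (N - (i + 1)) + 1 = N + 1 by omega]
  have hrange : ∀ (g : ℕ → ℂ) (N : ℕ),
      ∑ m ∈ Finset.Icc 1 N, g m = ∑ i ∈ Finset.range N, g (i + 1) := by
    intro g N
    induction N with
    | zero => simp
    | succ N ih => rw [Finset.sum_Icc_succ_top (by omega), ih, Finset.sum_range_succ]
  induction N with
  | zero => simp
  | succ N ih =>
    simp_rw [Finset.sum_Icc_succ_top (show 1 ≤ N + 1 by omega)]
    rw [Finset.sum_add_distrib, ih, htri f N, htri (fun m n => f n m) N,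
      Finset.sum_range_succ (fun i => f (i + 1) (i + 1)), hrange, hrange]
    ring

/-- For a row m ≤ N, integral and cell errors recombine into a tail from m, and removing its terms
up to N leaves the tail from N. For the rows m > N the two ingredients stay separate. -/
theorem mtCone_sub_mtConeSum {s : ℂ × ℂ × ℂ} (h1 : 0 < s.2.1.re + s.2.2.re)
    (h2 : 1 < s.1.re + s.2.1.re + s.2.2.re) (h3 : s.2.1 + s.2.2 ≠ 1)
    (h4 : s.1 + s.2.1 + s.2.2 - 1 ≠ 1) {N : ℕ} (hN : 1 ≤ N) :
    mtCone s - mtConeSum s N =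
      ∑ i ∈ Finset.range N, ((i + 1 : ℕ) : ℂ) ^ (-s.1) * mtTail (i + 1 : ℕ) s.2.1 s.2.2 N +
      mtTailInt 1 s.2.1 s.2.2 1 * mtTail 0 (s.1 + s.2.1 + s.2.2 - 1) 0 N +
      ∑' j : ℕ, ((N + j + 1 : ℕ) : ℂ) ^ (-s.1) * ∑' k : ℕ,
        mtCellErr (N + j + 1 : ℕ) s.2.1 s.2.2 ((N + j + 1 : ℕ) + k) := by
  have hse := summable_mtConeErr h1 h2
  have hrow : HasSum (fun m : ℕ => ∑' k : ℕ, mtConeErr s (m, k)) (∑' p, mtConeErr s p) :=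
    hse.hasSum.prod_fiberwise fun m => (hse.prod_factor m).hasSum
  have hrow' : ∀ m : ℕ, ∑' k : ℕ, mtConeErr s (m, k) = ((m + 1 : ℕ) : ℂ) ^ (-s.1) *
      ∑' k : ℕ, mtCellErr (m + 1 : ℕ) s.2.1 s.2.2 ((m + 1 : ℕ) + k) := fun m => by
    rw [← tsum_mul_left]; rfl
  rw [mtCone, zetaRight_eq_sum_add (by simp only [Complex.add_re, Complex.sub_re, Complex.one_re]
                                       linarith) h4 hN,
    ← hrow.tsum_eq, ← hrow.summable.sum_add_tsum_nat_add N]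
  have htail : ∀ i : ℕ, ∑' k : ℕ, mtConeErr s (i + N, k) = ((N + i + 1 : ℕ) : ℂ) ^ (-s.1) *
      ∑' k : ℕ, mtCellErr (N + i + 1 : ℕ) s.2.1 s.2.2 ((N + i + 1 : ℕ) + k) := fun i => by
    rw [add_comm i N]; exact hrow' _
  simp_rw [htail]
  have hfin : mtTailInt 1 s.2.1 s.2.2 1 * ∑ i ∈ Finset.range N,
      (((i + 1 : ℕ) : ℝ) : ℂ) ^ (-(s.1 + s.2.1 + s.2.2 - 1)) +
      ∑ i ∈ Finset.range N, ∑' k : ℕ, mtConeErr s (i, k) - mtConeSum s N =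
      ∑ i ∈ Finset.range N, ((i + 1 : ℕ) : ℂ) ^ (-s.1) * mtTail (i + 1 : ℕ) s.2.1 s.2.2 N := by
    rw [mtConeSum, Finset.mul_sum, ← Finset.sum_add_distrib, ← Finset.sum_sub_distrib]
    refine Finset.sum_congr rfl fun i hi => ?_
    have hiN := Finset.mem_range.1 hi
    have h := sum_range_add_mtTail (m := (i + 1 : ℕ)) (N := i + 1) (by positivity) le_rfl
      (by omega) h1 h3 (N - (i + 1))
    rw [show i + 1 + (N - (i + 1)) = N by omega] at h
    rw [← cpow_mul_mtTailInt_self s (i + 1) (by omega), hrow', ← mul_add]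
    have h' : mtTailInt (i + 1 : ℕ) s.2.1 s.2.2 (i + 1 : ℕ) +
        ∑' k : ℕ, mtCellErr (i + 1 : ℕ) s.2.1 s.2.2 ((i + 1 : ℕ) + k)
        = mtTail (i + 1 : ℕ) s.2.1 s.2.2 (i + 1) := rfl
    rw [h', ← h, mul_add, Finset.mul_sum, add_sub_right_comm, ← Finset.sum_sub_distrib]
    rw [Finset.sum_eq_zero fun k _ => ?_, zero_add]
    rw [mtTerm_eq]
    push_cast
    ring
  rw [← hfin]
  ring

theorem exists_norm_mtCone_sub_le {s₁ s₂ : ℂ} {σ B : ℝ} (h1i : 0 ≤ s₁.im)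
    (h2r : 0 ≤ s₂.re) (h2i : 0 ≤ s₂.im) (hσ : 0 < σ) (hsum : 1 < s₁.re + s₂.re + σ) :
    ∃ C : ℝ, 0 ≤ C ∧ ∀ (s₃ : ℂ) (N : ℕ), s₃.re = σ → 2 ≤ s₃.im → 1 ≤ N → s₃.im ≤ N + 1 →
      N ≤ B * s₃.im → ‖mtCone (s₁, s₂, s₃) - mtConeSum (s₁, s₂, s₃) N‖ ≤
        C * (N : ℝ) ^ (max s₁.re (3 / 2) - (s₁.re + s₂.re + σ)) := by
  obtain ⟨C₁, hC₁, h₁⟩ := exists_norm_mtTail_le (B := B) h2r h2i hσ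
  obtain ⟨C₂, hC₂, h₂⟩ := exists_sum_rpow_neg_le s₁.re
  obtain ⟨C₃, hC₃, h₃⟩ := exists_norm_tsum_mtCellErr_le h2r hσ
  set S := s₁.re + s₂.re + σ with hS
  set A := ‖s₁‖ + ‖s₂‖ + σ + 3 with hA
  set C₄ := 2 + 2 / (S - 1) + A * (2 ^ (S - 1 + 1) / (S - 1)) with hC₄
  set C₅ := 2 ^ |σ| * (2 + ‖s₂‖ / (s₂.re + σ)) with hC₅
  have hA0 : 0 ≤ A := by positivity
  have hS1 : 0 < S - 1 := by linarith
  refine ⟨C₂ * C₁ + C₅ * |B| * C₄ + C₃ * (2 ^ (S - 1 + 1) / (S - 1)), by positivity,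
    fun s₃ N hre him hN hN1 hNB => ?_⟩
  have hN' : (1 : ℝ) ≤ N := by exact_mod_cast hN
  have hN0 : (0 : ℝ) < N := by linarith
  have ht : 0 < s₃.im := by linarith
  have hne : ∀ z : ℂ, 0 < z.im → z ≠ 1 := fun z hz h => by rw [h] at hz; simp at hz
  have hexp : (N : ℝ) ^ (1 - S) ≤ (N : ℝ) ^ (max s₁.re (3 / 2) - S) :=
    Real.rpow_le_rpow_of_exponent_le hN' (by linarith [le_max_right s₁.re (3 / 2)])
  rw [mtCone_sub_mtConeSum (s := (s₁, s₂, s₃)) (by simp only [hre]; linarith)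
    (by simp only [hre]; linarith) (hne _ (by simp only [Complex.add_im]; linarith))
    (hne _ (by simp only [Complex.add_im, Complex.sub_im, Complex.one_im]; linarith)) hN]
  simp only
  rw [add_mul, add_mul]
  refine (norm_add_le _ _).trans (add_le_add ((norm_add_le _ _).trans (add_le_add ?_ ?_)) ?_)
  · calc _ ≤ ∑ i ∈ Finset.range N, ((i : ℝ) + 1) ^ (-s₁.re) *
          (C₁ * (N : ℝ) ^ (-(s₂.re + σ))) := by
          refine (norm_sum_le _ _).trans (Finset.sum_le_sum fun i hi => ?_)
          have hiN := Finset.mem_range.1 hi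
          rw [norm_mul, Complex.norm_natCast_cpow_of_pos (by omega), Complex.neg_re]
          have := h₁ s₃ (i + 1) N hre him (by omega) (by omega) hN1 hNB
          push_cast at this ⊢
          gcongr
      _ ≤ C₂ * (N : ℝ) ^ (max s₁.re (3 / 2) - s₁.re) * (C₁ * (N : ℝ) ^ (-(s₂.re + σ))) := by
          rw [← Finset.sum_mul]
          exact mul_le_mul_of_nonneg_right (h₂ N hN) (by positivity)
      _ = C₂ * C₁ * ((N : ℝ) ^ (max s₁.re (3 / 2) - s₁.re) * (N : ℝ) ^ (-(s₂.re + σ))) := by ring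
      _ = _ := by rw [← Real.rpow_add hN0]; congr 2; rw [hS]; ring
  -- The zeta tail is only O(N^(2-S)), but its coefficient is O(1/t₃) and N ≤ B t₃, so the product
  -- is O(N^(1-S)).
  · have hI := norm_mtTailInt_le (m := 1) (N := 1) (a := s₂) (b := s₃) zero_le_one le_rfl one_pos
      (by rw [hre]; linarith)
    rw [hre, Real.one_rpow, mul_one, ← hC₅] at hI
    have him2 : s₃.im ≤ ‖s₂ + s₃ - 1‖ := by
      have := (le_abs_self _).trans (Complex.abs_im_le_norm (s₂ + s₃ - 1))
      simp only [Complex.add_im, Complex.sub_im, Complex.one_im] at this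
      linarith
    have hI' : ‖mtTailInt 1 s₂ s₃ 1‖ ≤ C₅ / s₃.im :=
      hI.trans (div_le_div_of_nonneg_left (by positivity) ht him2)
    have hzre : (s₁ + s₂ + s₃ - 1).re = S - 1 := by
      simp only [Complex.add_re, Complex.sub_re, Complex.one_re, hre, hS]
    have hz1 : 1 ≤ ‖s₁ + s₂ + s₃ - 1 - 1‖ := by
      have := (le_abs_self _).trans (Complex.abs_im_le_norm (s₁ + s₂ + s₃ - 1 - 1))
      simp only [Complex.add_im, Complex.sub_im, Complex.one_im] at this
      linarith
    have hn3 : ‖s₃‖ ≤ σ + s₃.im := by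
      have := Complex.norm_le_abs_re_add_abs_im s₃
      rwa [hre, abs_of_pos hσ, abs_of_pos ht] at this
    have hzA : ‖s₁ + s₂ + s₃ - 1‖ ≤ A * N := by
      have e1 := norm_sub_le (s₁ + s₂ + s₃) 1
      have e2 := norm_add_le (s₁ + s₂) s₃
      have e3 := norm_add_le s₁ s₂
      rw [norm_one] at e1
      have e4 : 0 ≤ (‖s₁‖ + ‖s₂‖ + σ) * (N - 1) := mul_nonneg (by positivity) (by linarith)
      rw [hA]
      nlinarith
    have hT := norm_mtTail_zero_le (by rw [hzre]; exact hS1) hz1 hN hzA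
    rw [hzre, ← hC₄] at hT
    rw [norm_mul]
    have hC₄0 : 0 ≤ C₄ := by positivity
    have hNt : (N : ℝ) / s₃.im ≤ |B| := by
      rw [div_le_iff₀ ht]
      exact hNB.trans (mul_le_mul_of_nonneg_right (le_abs_self B) ht.le)
    have e : (N : ℝ) ^ (1 - (S - 1)) = N * (N : ℝ) ^ (1 - S) := by
      rw [show 1 - (S - 1) = 1 + (1 - S) by ring, Real.rpow_add hN0, Real.rpow_one]
    calc _ ≤ C₅ / s₃.im * (C₄ * (N * (N : ℝ) ^ (1 - S))) := by
          rw [← e]; gcongr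
      _ = C₅ * (N / s₃.im) * C₄ * (N : ℝ) ^ (1 - S) := by ring
      _ ≤ C₅ * |B| * C₄ * (N : ℝ) ^ (max s₁.re (3 / 2) - S) := by gcongr
  · have hb : ∀ j : ℕ, ‖((N + j + 1 : ℕ) : ℂ) ^ (-s₁) * ∑' k : ℕ,
        mtCellErr (N + j + 1 : ℕ) s₂ s₃ ((N + j + 1 : ℕ) + k)‖ ≤
        C₃ * ((N : ℝ) + j) ^ (-(S - 1) - 1) := by
      intro j
      have h := h₃ s₃ (N + j + 1) (N + j + 1) hre him (by omega) le_rfl (by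
        push_cast; linarith [(Nat.cast_nonneg j : (0 : ℝ) ≤ j)])
      rw [norm_mul, Complex.norm_natCast_cpow_of_pos (by omega), Complex.neg_re]
      have hpos : (0 : ℝ) < ((N + j + 1 : ℕ) : ℝ) := by positivity
      calc _ ≤ ((N + j + 1 : ℕ) : ℝ) ^ (-s₁.re) *
            (C₃ * ((N + j + 1 : ℕ) : ℝ) ^ (-(s₂.re + σ))) := by gcongr
        _ = C₃ * ((N + j + 1 : ℕ) : ℝ) ^ (-(S - 1) - 1) := by
            rw [mul_left_comm, ← Real.rpow_add hpos]; congr 2; rw [hS]; ring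
        _ ≤ _ := by
            refine mul_le_mul_of_nonneg_left (Real.rpow_le_rpow_of_nonpos (by positivity) ?_
              (by linarith)) hC₃
            push_cast; linarith
    refine (norm_tsum_le_rpow_tail hS1 hN hb).trans ?_
    rw [neg_sub]
    gcongr

theorem exists_norm_diag_sub_le {s₁ s₂ : ℂ} {σ : ℝ} (h1i : 0 ≤ s₁.im) (h2i : 0 ≤ s₂.im)
    (hσ : 0 < σ) (hsum : 0 < s₁.re + s₂.re + σ) :
    ∃ C : ℝ, 0 ≤ C ∧ ∀ (s₃ : ℂ) (N : ℕ), s₃.re = σ → 2 ≤ s₃.im → 1 ≤ N → s₃.im ≤ N + 1 →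
      ‖2 ^ (-s₃) * zetaRight (s₁ + s₂ + s₃) -
          ∑ i ∈ Finset.range N, mtTerm (s₁, s₂, s₃) (i + 1) (i + 1)‖ ≤
        C * (N : ℝ) ^ (1 - (s₁.re + s₂.re + σ)) := by
  set S := s₁.re + s₂.re + σ with hS
  set A := ‖s₁‖ + ‖s₂‖ + σ + 2 with hA
  have hA0 : 0 ≤ A := by positivity
  refine ⟨2 + 2 / S + A * (2 ^ (S + 1) / S), by positivity, fun s₃ N hre him hN hN1 => ?_⟩
  have hN' : (1 : ℝ) ≤ N := by exact_mod_cast hN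
  have ht : 0 < s₃.im := by linarith
  have hzre : (s₁ + s₂ + s₃).re = S := by simp only [Complex.add_re, hre, hS]
  have hz1 : 1 ≤ ‖s₁ + s₂ + s₃ - 1‖ := by
    have := (le_abs_self _).trans (Complex.abs_im_le_norm (s₁ + s₂ + s₃ - 1))
    simp only [Complex.add_im, Complex.sub_im, Complex.one_im] at this
    linarith
  have hne : s₁ + s₂ + s₃ ≠ 1 := fun h => by rw [h, sub_self, norm_zero] at hz1; linarith
  have hn3 : ‖s₃‖ ≤ σ + s₃.im := by
    have := Complex.norm_le_abs_re_add_abs_im s₃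
    rwa [hre, abs_of_pos hσ, abs_of_pos ht] at this
  have hzA : ‖s₁ + s₂ + s₃‖ ≤ A * N := by
    have e2 := norm_add_le (s₁ + s₂) s₃
    have e3 := norm_add_le s₁ s₂
    have e4 : 0 ≤ (‖s₁‖ + ‖s₂‖ + σ) * (N - 1) := mul_nonneg (by positivity) (by linarith)
    rw [hA]
    nlinarith
  have hT := norm_mtTail_zero_le (by rw [hzre]; exact hsum) hz1 hN hzA
  rw [hzre] at hT
  have heq : 2 ^ (-s₃) * zetaRight (s₁ + s₂ + s₃) -
      ∑ i ∈ Finset.range N, mtTerm (s₁, s₂, s₃) (i + 1) (i + 1)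
      = 2 ^ (-s₃) * mtTail 0 (s₁ + s₂ + s₃) 0 N := by
    rw [zetaRight_eq_sum_add (by rw [hzre]; exact hsum) hne hN, mul_add, Finset.mul_sum,
      Finset.sum_congr rfl fun i _ => mtTerm_diag (s₁, s₂, s₃) (i + 1) (by omega)]
    ring
  rw [heq, norm_mul]
  have h2 : ‖(2 : ℂ) ^ (-s₃)‖ ≤ 1 := by
    have := Complex.norm_cpow_eq_rpow_re_of_pos (x := 2) two_pos (-s₃)
    rw [Complex.ofReal_ofNat] at this
    rw [this, Complex.neg_re, hre]
    exact Real.rpow_le_one_of_one_le_of_nonpos (by norm_num) (by linarith)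
  calc _ ≤ 1 * _ := mul_le_mul h2 hT (norm_nonneg _) zero_le_one
    _ = _ := one_mul _

/-! ### Assembly -/

theorem rpow_le_of_half_le_of_le {x y B : ℝ} (hy : 0 < y) (hB : 0 < B) (h1 : y / 2 ≤ x)
    (h2 : x ≤ B * y) (e : ℝ) : x ^ e ≤ (B ^ e + 2 ^ (-e)) * y ^ e := by
  rcases le_total 0 e with he | he
  · calc x ^ e ≤ (B * y) ^ e := Real.rpow_le_rpow (by linarith) h2 he
      _ = B ^ e * y ^ e := Real.mul_rpow hB.le hy.le
      _ ≤ _ := by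
        have : (0 : ℝ) < 2 ^ (-e) := by positivity
        gcongr
        linarith
  · calc x ^ e ≤ (y / 2) ^ e := Real.rpow_le_rpow_of_nonpos (by linarith) h1 he
      _ = 2 ^ (-e) * y ^ e := by
        rw [Real.div_rpow hy.le (by norm_num), Real.rpow_neg (by norm_num)]; ring
      _ ≤ _ := by
        have : (0 : ℝ) < B ^ e := by positivity
        gcongr
        linarith

theorem exists_norm_mordellTornheimZeta_sub_le {s₁ s₂ : ℂ} {σ : ℝ} (h1r : 0 ≤ s₁.re)
    (h1i : 0 ≤ s₁.im) (h2r : 0 ≤ s₂.re) (h2i : 0 ≤ s₂.im) (hσ : 0 < σ) (h1 : 1 / 2 < s₁.re + σ)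
    (h2 : 1 / 2 < s₂.re + σ) (hsum : 3 / 2 < s₁.re + s₂.re + σ) {B : ℝ} (hB : 1 ≤ B) :
    ∃ C : ℝ, 0 ≤ C ∧ ∀ s₃ : ℂ, s₃.re = σ → 2 ≤ s₃.im →
      ‖mordellTornheimZeta (s₁, s₂, s₃) - mtPartialSum (s₁, s₂, s₃) (B * s₃.im)‖ ≤
        C * s₃.im ^ (max (max s₁.re s₂.re) (3 / 2) - (s₁.re + s₂.re + σ)) := by
  obtain ⟨C₁, hC₁, h₁⟩ := exists_norm_mtCone_sub_le (B := B) h1i h2r h2i hσ (by linarith)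
  obtain ⟨C₂, hC₂, h₂⟩ := exists_norm_mtCone_sub_le (B := B) h2i h1r h1i hσ (by linarith)
  obtain ⟨C₃, hC₃, h₃⟩ := exists_norm_diag_sub_le h1i h2i hσ (by linarith)
  set S := s₁.re + s₂.re + σ with hS
  rw [add_comm s₂.re s₁.re, ← hS] at h₂
  set M := max (max s₁.re s₂.re) (3 / 2) with hM
  refine ⟨(C₁ + C₂ + C₃) * (B ^ (M - S) + 2 ^ (-(M - S))), by positivity, fun s₃ hre him => ?_⟩
  set t := s₃.im with ht
  have hBt : 2 ≤ B * t := by nlinarith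
  set N := ⌊B * t⌋₊ with hN
  have hNle : (N : ℝ) ≤ B * t := Nat.floor_le (by linarith)
  have hNlt : B * t < N + 1 := Nat.lt_floor_add_one _
  have hN1 : 1 ≤ N := Nat.le_floor (by push_cast; linarith)
  have hN' : (1 : ℝ) ≤ N := by exact_mod_cast hN1
  have htN : t ≤ N + 1 := by nlinarith
  rw [isMTContinuation_mordellTornheimZeta.eq_of_im_pos isMTContinuation_mtExplicit h1i h2i
    (by linarith) (by rw [hre]; exact h1) (by rw [hre]; exact h2) (by rw [hre]; exact hsum),
    mtPartialSum, sum_square_eq, mtExplicit]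
  simp only
  rw [← hN]
  have hsplit : mtCone (s₁, s₂, s₃) + mtCone (s₂, s₁, s₃) + 2 ^ (-s₃) * zetaRight (s₁ + s₂ + s₃) -
      (∑ i ∈ Finset.range N, ∑ k ∈ Finset.range (N - (i + 1)),
          mtTerm (s₁, s₂, s₃) (i + 1) (i + 1 + k + 1) +
        ∑ i ∈ Finset.range N, ∑ k ∈ Finset.range (N - (i + 1)),
          mtTerm (s₁, s₂, s₃) (i + 1 + k + 1) (i + 1) +
        ∑ i ∈ Finset.range N, mtTerm (s₁, s₂, s₃) (i + 1) (i + 1)) =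
      (mtCone (s₁, s₂, s₃) - mtConeSum (s₁, s₂, s₃) N) +
      (mtCone (s₂, s₁, s₃) - mtConeSum (s₂, s₁, s₃) N) +
      (2 ^ (-s₃) * zetaRight (s₁ + s₂ + s₃) -
        ∑ i ∈ Finset.range N, mtTerm (s₁, s₂, s₃) (i + 1) (i + 1)) := by
    rw [mtConeSum, mtConeSum]
    simp_rw [mtTerm_swap s₂ s₁ s₃]
    ring
  rw [hsplit]
  -- N and t are comparable: t/2 ≤ N since N > t - 1 and t ≥ 2. Adding both constants covers either
  -- sign of M - S.
  have hmono : ∀ e : ℝ, e ≤ M - S → (N : ℝ) ^ e ≤ (B ^ (M - S) + 2 ^ (-(M - S))) * t ^ (M - S) :=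
    fun e he => (Real.rpow_le_rpow_of_exponent_le hN' he).trans
      (rpow_le_of_half_le_of_le (by linarith) (by linarith) (by nlinarith) hNle _)
  have g1 := (h₁ s₃ N hre him hN1 htN hNle).trans (mul_le_mul_of_nonneg_left (hmono _
    (sub_le_sub_right (max_le_max_right _ (le_max_left _ _)) _)) hC₁)
  have g2 := (h₂ s₃ N hre him hN1 htN hNle).trans (mul_le_mul_of_nonneg_left (hmono _
    (sub_le_sub_right (max_le_max_right _ (le_max_right _ _)) _)) hC₂)
  have g3 := (h₃ s₃ N hre him hN1 htN).trans (mul_le_mul_of_nonneg_left (hmono _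
    (by linarith [le_max_right (max s₁.re s₂.re) (3 / 2)])) hC₃)
  calc _ ≤ _ := (norm_add_le _ _).trans (add_le_add_left (norm_add_le _ _) _)
    _ ≤ _ := add_le_add (add_le_add g1 g2) g3
    _ = _ := by ring

theorem corollary4p1 :
    IsMTContinuation mordellTornheimZeta ∧
    ∀ (s₁ s₂ : ℂ) (σ₃ : ℝ),
      0 ≤ s₁.re → 0 ≤ s₁.im → 0 ≤ s₂.re → 0 ≤ s₂.im →
      0 < σ₃ → 1 / 2 - s₁.re < σ₃ → 1 / 2 - s₂.re < σ₃ → 3 / 2 - s₁.re - s₂.re < σ₃ →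
      ∃ C : ℝ, ∀ (t₃ : ℝ) (s₃ : ℂ), 2 ≤ t₃ → s₃ = (σ₃ : ℂ) + (t₃ : ℂ) * Complex.I →
        s₁ + s₃ ≠ 1 → s₂ + s₃ ≠ 1 → s₁ + s₂ + s₃ ≠ 2 →
        (3 / 2 < max s₁.re s₂.re →
          ‖mordellTornheimZeta (s₁, s₂, s₃) -
              mtPartialSum (s₁, s₂, s₃) (max 1 (max |s₁.im| |s₂.im|) * t₃)‖ ≤
            C * t₃ ^ (-min (s₁.re + σ₃) (s₂.re + σ₃))) ∧
        (max s₁.re s₂.re = 3 / 2 →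
          ‖mordellTornheimZeta (s₁, s₂, s₃) -
              mtPartialSum (s₁, s₂, s₃) (max 1 (max |s₁.im| |s₂.im|) * t₃)‖ ≤
            C * (t₃ ^ (-min (s₁.re + σ₃) (s₂.re + σ₃)) * Real.log t₃)) ∧
        (s₁.re < 3 / 2 ∧ s₂.re < 3 / 2 →
          ‖mordellTornheimZeta (s₁, s₂, s₃) -
              mtPartialSum (s₁, s₂, s₃) (max 1 (max |s₁.im| |s₂.im|) * t₃)‖ ≤
            C * t₃ ^ (3 / 2 - s₁.re - s₂.re - σ₃)) := by
  refine ⟨isMTContinuation_mordellTornheimZeta,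
    fun s₁ s₂ σ₃ h1r h1i h2r h2i hσ h1 h2 h3 => ?_⟩
  obtain ⟨C, hC0, hC⟩ := exists_norm_mordellTornheimZeta_sub_le h1r h1i h2r h2i hσ
    (by linarith) (by linarith) (by linarith)
    (le_max_left (1 : ℝ) (max |s₁.im| |s₂.im|))
  have hlog : 0 < Real.log 2 := Real.log_pos (by norm_num)
  -- The factor 1 / log 2 inserts the logarithm of the middle case, as log t ≥ log 2; the 1 keeps
  -- the constant large enough for the other two.
  refine ⟨C * max 1 (1 / Real.log 2), fun t s₃ ht hs₃ _ _ _ => ?_⟩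
  have hre : s₃.re = σ₃ := by rw [hs₃]; simp
  have him : s₃.im = t := by rw [hs₃]; simp
  have key := hC s₃ hre (by rw [him]; exact ht)
  rw [him] at key
  have hmax : s₁.re + s₂.re + σ₃ - max s₁.re s₂.re = min (s₁.re + σ₃) (s₂.re + σ₃) := by
    rcases le_total s₁.re s₂.re with h | h
    · rw [max_eq_right h, min_eq_left (by linarith)]; ring
    · rw [max_eq_left h, min_eq_right (by linarith)]; ring
  have hle : ∀ x : ℝ, 0 ≤ x → C * x ≤ C * max 1 (1 / Real.log 2) * x := fun x hx => by
    rw [mul_assoc]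
    exact mul_le_mul_of_nonneg_left (le_mul_of_one_le_left hx (le_max_left _ _)) hC0
  refine ⟨fun h => ?_, fun h => ?_, fun h => ?_⟩
  · rw [max_eq_left h.le, ← neg_sub (s₁.re + s₂.re + σ₃), hmax] at key
    exact key.trans (hle _ (by positivity))
  · rw [max_eq_left h.ge, ← neg_sub (s₁.re + s₂.re + σ₃), hmax] at key
    refine key.trans ?_
    rw [mul_assoc]
    refine mul_le_mul_of_nonneg_left ?_ hC0
    have hlt : Real.log 2 ≤ Real.log t := Real.log_le_log (by norm_num) ht
    have h1 : 1 ≤ max 1 (1 / Real.log 2) * Real.log t := by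
      calc (1 : ℝ) = 1 / Real.log 2 * Real.log 2 := by field_simp
        _ ≤ _ := mul_le_mul (le_max_right _ _) hlt hlog.le (by positivity)
    calc t ^ (-min (s₁.re + σ₃) (s₂.re + σ₃))
        ≤ t ^ (-min (s₁.re + σ₃) (s₂.re + σ₃)) * (max 1 (1 / Real.log 2) * Real.log t) :=
          le_mul_of_one_le_right (by positivity) h1
      _ = _ := by ring
  · rw [max_eq_right (max_le h.1.le h.2.le),
      show 3 / 2 - (s₁.re + s₂.re + σ₃) = 3 / 2 - s₁.re - s₂.re - σ₃ by ring] at key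
    exact key.trans (hle _ (by positivity))
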